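/- Let $\mathcal L$ be a complex Hilbert space (the system's Liouville space), let $\mathcal B=\mathcal B(\mathcal L)$ be its bounded operators with the operator norm, and let $1<p<\infty$. Let $\tilde K:\mathbb H_+\to\mathcal B$ belong to the vector-valued Hardy space $H^p(\mathcal B)$ of the upper half-plane $\mathbb H_+$, that is, $\tilde K$ is analytic and $\sup_{y>0}\int_{\mathbb R}\|\tilde K(x+iy)\|^p\,dx<\infty$; it is not required that $\tilde K\in H^1(\mathcal B)$. For $a\in\mathcal B$ write $a'=(a+a^*)/2$ and $a''=(a-a^*)/(2i)$. Suppose that $\mathcal L$ is finite-dimensional. Then there is $k\in L^p(\mathbb R;\mathcal B)$ which is the boundary value of $\tilde K$: $\tilde K\to k$ non-tangentially almost everywhere, and $\tilde K(\cdot+iy)\to k$ in $L^p$ as $y\to0^+$. It satisfies the following. 1. (Kramers–Kronig relation.) For almost every real $\omega$ the principal value exists in operator norm and $$k'(\omega)=\frac1\pi\,\mathcal P\!\int_{-\infty}^{\infty}\frac{k''(t)}{t-\omega}\,dt;$$ moreover the truncated integrals $\frac1\pi\int_{|t-\omega|>\varepsilon}\frac{k''(t)}{t-\omega}\,dt$ converge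 to $k'$ in $L^p(\mathbb R;\mathcal B)$ as $\varepsilon\to0^+$. 2. (Once-subtracted relation.) Let $\omega_*\in\mathbb R$ be a point where $\tilde K$ has a finite boundary value $\tilde K(\omega_*):=\lim_{y\to0^+}\tilde K(\omega_*+iy)$. Then for almost every real $\omega$ for which the principal-value integral on the right (singular points $\omega_*$ and $\omega$, symmetric truncation) converges, $$k'(\omega)-\tilde K(\omega_*)'=\frac{\omega-\omega_*}{\pi}\,\mathcal P\!\int_{-\infty}^{\infty}\frac{k''(t)}{(t-\omega_*)(t-\omega)}\,dt .$$ If the principal value $\mathcal P\!\int \frac{k''(t)}{t-\omega_*}\,dt$ at the subtraction point converges, then the integral on the right converges, and the relation holds, for almost every $\omega$. Whether or not $\mathcal L$ is finite-dimensional, for all $\xi,\eta\in\mathcal L$ the scalar function $z\mapsto\langle\xi,\tilde K(z)\eta\rangle$ has a boundary value in $L^p(\mathbb R)$ in the same sense, and 1 and 2 hold for it with $'$ and $''$ denoting the ordinary real and imaginary parts. -/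

import Mathlib

open MeasureTheory Filter Topology
open scoped ENNReal ComplexStarModule InnerProductSpace

/-- `F` belongs to the Hardy space `H^p` of the upper half-plane with values in `E`: it is analytic
there and the `L^p` norms over the horizontal lines `Im z = y`, `y > 0`, are uniformly bounded.
The values of `F` off the open upper half-plane play no role. -/
def MemHardy {E : Type*} [NormedAddCommGroup E] [NormedSpace ℂ E]
    (p : ℝ≥0∞) (F : ℂ → E) : Prop :=
  DifferentiableOn ℂ F {z : ℂ | 0 < z.im} ∧
    (⨆ (y : ℝ) (_ : 0 < y), eLpNorm (fun x : ℝ => F (x + y * Complex.I)) p volume) < ∞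

/-- The non-tangential approach region in the upper half-plane with vertex `x` and aperture `a`. -/
def stolzCone (x a : ℝ) : Set ℂ := {z : ℂ | 0 < z.im ∧ |z.re - x| < a * z.im}

/-- `f` is the `L^p` boundary value on the real line of the function `F` on the upper half-plane:
`f ∈ L^p`, the non-tangential limit of `F` is `f` almost everywhere, and `F (· + i y) → f` in `L^p`
as `y → 0+`. -/
def IsBoundaryValue {E : Type*} [NormedAddCommGroup E] [NormedSpace ℂ E]
    (p : ℝ≥0∞) (F : ℂ → E) (f : ℝ → E) : Prop :=
  MemLp f p volume ∧
    (∀ᵐ x : ℝ, ∀ a : ℝ, 0 < a → Tendsto F (𝓝[stolzCone x a] (x : ℂ)) (𝓝 (f x))) ∧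
    Tendsto (fun y : ℝ => eLpNorm (fun x : ℝ => F (x + y * Complex.I) - f x) p volume)
      (𝓝[>] 0) (𝓝 0)

/-- The real line with symmetric `ε`-neighbourhoods of the points of `S` removed. -/
def excised (S : Set ℝ) (ε : ℝ) : Set ℝ := {t : ℝ | ∀ s ∈ S, ε < |t - s|}

/-- The principal-value integral of `g` over the real line, with singular points `S`, exists and
equals `L`. -/
def HasPV {E : Type*} [NormedAddCommGroup E] [NormedSpace ℂ E]
    (g : ℝ → E) (S : Set ℝ) (L : E) : Prop :=
  (∀ ε : ℝ, 0 < ε → IntegrableOn g (excised S ε) volume) ∧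
    Tendsto (fun ε : ℝ => ∫ t in excised S ε, g t) (𝓝[>] 0) (𝓝 L)

/-- The Kramers-Kronig relation `Re f (ω) = (1/π) P∫ Im f (t) / (t - ω) dt` in the
principal-value sense: the principal value exists and the identity holds for almost every `ω`, and
the truncated integrals converge to `Re f` in `L^p`. Here `Re` and `Im` are the parts
`(a + a⋆) / 2` and `(a - a⋆) / (2 i)`: the Hermitian parts of an operator, the usual parts of a
complex number. -/
def PVKramersKronig {E : Type*} [NormedAddCommGroup E] [NormedSpace ℂ E]
    [StarAddMonoid E] [StarModule ℂ E] (p : ℝ≥0∞) (f : ℝ → E) : Prop :=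
  (∀ᵐ ω : ℝ, ∃ L : E, HasPV (fun t : ℝ => (t - ω)⁻¹ • (ℑ (f t) : E)) {ω} L ∧
    (ℜ (f ω) : E) = (1 / Real.pi) • L) ∧
  Tendsto (fun ε : ℝ => eLpNorm (fun ω : ℝ =>
      (1 / Real.pi) • (∫ t in excised {ω} ε, (t - ω)⁻¹ • (ℑ (f t) : E)) - (ℜ (f ω) : E)) p volume)
    (𝓝[>] 0) (𝓝 0)

/-- The once-subtracted Kramers-Kronig relation
`Re f (ω) - Re A = ((ω - ω₀) / π) P∫ Im f (t) / ((t - ω₀) (t - ω)) dt`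
at every real point `ω₀` at which `F` has a finite boundary value `A`:
* it holds at almost every `ω` at which the principal value on the right-hand side converges;
* if the singularity at `ω₀` is convergent in the principal-value sense, then that principal value
  does converge, and the relation holds, for almost every `ω`. -/
def SubtractedKramersKronig {E : Type*} [NormedAddCommGroup E] [NormedSpace ℂ E]
    [StarAddMonoid E] [StarModule ℂ E] (F : ℂ → E) (f : ℝ → E) : Prop :=
  ∀ (ω₀ : ℝ) (A : E),
    Tendsto (fun y : ℝ => F (ω₀ + y * Complex.I)) (𝓝[>] 0) (𝓝 A) →
    (∀ᵐ ω : ℝ, ∀ L : E,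
      HasPV (fun t : ℝ => ((t - ω₀) * (t - ω))⁻¹ • (ℑ (f t) : E)) {ω₀, ω} L →
      (ℜ (f ω) : E) - (ℜ A : E) = ((ω - ω₀) / Real.pi) • L) ∧
    ((∃ M : E, HasPV (fun t : ℝ => (t - ω₀)⁻¹ • (ℑ (f t) : E)) {ω₀} M) →
      ∀ᵐ ω : ℝ, ∃ L : E,
        HasPV (fun t : ℝ => ((t - ω₀) * (t - ω))⁻¹ • (ℑ (f t) : E)) {ω₀, ω} L ∧
        (ℜ (f ω) : E) - (ℜ A : E) = ((ω - ω₀) / Real.pi) • L)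

/-!
# Kramers-Kronig relations for Hardy functions of the upper half-plane

The proof rests on a pair of identities (`IsCauchyRepr`): a function `F` in `H^p`, `1 < p < ∞`, is
the Cauchy integral of its boundary function `f`, and the Cauchy integral of `f` vanishes in the
lower half-plane. Subtracting the values at conjugate points shows that `F` is the Poisson integral
of `f`; adding them shows that the conjugate Poisson integral of `f` is `i F`. So the Hilbert
transform of `f` is known to be `i f` from the start, and no boundedness theorem for singular
integrals is needed: a truncated Hilbert transform and a conjugate Poisson integral at the same
scale differ by an odd kernel dominated by the Poisson kernel. All limits, almost everywhere and in
`L^p`, thus follow from one fact, that the mean oscillation `poissonOsc` of `f` against the Poisson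
kernel tends to zero in both senses (`ae_tendsto_poissonOsc`, `tendsto_eLpNorm_poissonOsc`). Taking
imaginary parts of `Hf = i f`, with the real-linear map `a ↦ (a - a⋆) / (2 i)`, gives the
Kramers-Kronig relation.

The boundary function exists because the restrictions `F_y` of `F` to the lines `Im z = y` are
Cauchy in `L^p` as `y → 0` (`MemHardy.exists_isCauchyRepr_complex`). Cauchy's formula on these
lines (`MemHardy.isCauchyRepr_line`) makes `F_{y+s}` a Poisson average of `F_y`, so norms of the
`F_y`, and of their midpoints, increase as `y` decreases; uniform convexity of `L^p` then forces
convergence (`cauchy_map_of_midpoint`). Values in a finite-dimensional space are treated by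
coordinates.

For the once-subtracted relation, partial fractions write the two-point integral as a difference of
Hilbert transforms at `ω` and `ω₀`. At `ω₀`, which need not be a Lebesgue point of `f`, the
principal value is identified by an Abelian theorem
(`tendsto_conjPoisson_of_tendsto_truncated`): conjugate Poisson integrals are averages of truncated
Hilbert transforms, so they tend to the principal value whenever it exists; but they equal
`π ℜ F(ω₀ + i y)`, which tends to `π ℜ F(ω₀)`.
-/

/-! ### The Poisson oscillation of an `L^p` function -/

/-- The mean oscillation `∫ P_y(t) ‖f (x + t) - f x‖ dt` of `f` at `x` against the Poisson kernel
`P_y(t) = y / (π (y² + t²))`, written with `t = y s` as an integral against the standard Cauchy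
distribution. -/
noncomputable def poissonOsc {E : Type*} [NormedAddCommGroup E] (f : ℝ → E) (y x : ℝ) : ℝ≥0∞ :=
  ∫⁻ s, ‖f (x + y * s) - f x‖ₑ ∂(ProbabilityTheory.cauchyMeasure 0 1)

lemma lintegral_cauchyMeasure (g : ℝ → ℝ≥0∞) (hg : Measurable g) :
    ∫⁻ s, g s ∂(ProbabilityTheory.cauchyMeasure 0 1) =
      ∫⁻ s, ENNReal.ofReal (Real.pi⁻¹ * (1 + s ^ 2)⁻¹) * g s := by
  rw [ProbabilityTheory.cauchyMeasure_of_scale_ne_zero 0 one_ne_zero,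
    lintegral_withDensity_eq_lintegral_mul _ (ProbabilityTheory.measurable_cauchyPDF 0 1) hg]
  refine lintegral_congr fun s => ?_
  simp [ProbabilityTheory.cauchyPDF_def, ProbabilityTheory.cauchyPDFReal_def, add_comm]

section Osc

variable {E : Type*} [NormedAddCommGroup E] {p : ℝ≥0∞} {f : ℝ → E}

lemma tendsto_eLpNorm_translate (hp : 1 ≤ p) (hp_top : p ≠ ∞) (hf : MemLp f p volume) :
    Tendsto (fun t : ℝ => eLpNorm (fun x => f (x + t) - f x) p volume) (𝓝 0) (𝓝 0) := by
  have : Fact (1 ≤ p) := ⟨hp⟩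
  let g : ℝ → C(ℝ, ℝ) := fun t => ⟨fun x => x + t, by fun_prop⟩
  have hg : Continuous g := by
    let G : C(ℝ × ℝ, ℝ) := ⟨fun q => q.2 + q.1, by fun_prop⟩
    exact G.curry.continuous
  have hgm : ∀ t, MeasurePreserving (g t) (volume : Measure ℝ) volume :=
    fun t => measurePreserving_add_right volume t
  have hc : Continuous fun t => Lp.compMeasurePreserving (g t) (hgm t) (hf.toLp f) :=
    continuous_const.compMeasurePreservingLp hg hgm hp_top
  have h0 := (hc.tendsto 0).sub_const (hf.toLp f)
  have hz : Lp.compMeasurePreserving (g 0) (hgm 0) (hf.toLp f) = hf.toLp f := by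
    rw [Lp.toLp_compMeasurePreserving hf]
    congr 1
    ext x; simp [g]
  rw [hz, sub_self] at h0
  have h1 := (continuous_enorm.tendsto _).comp h0
  simp only [enorm_zero] at h1
  refine h1.congr fun t => ?_
  simp only [Function.comp_apply]
  rw [Lp.toLp_compMeasurePreserving hf, ← MemLp.toLp_sub, Lp.enorm_toLp]
  rfl

lemma eLpNorm_translate_le (hp : 1 ≤ p) (hf : MemLp f p volume) (t : ℝ) :
    eLpNorm (fun x => f (x + t) - f x) p volume ≤ 2 * eLpNorm f p volume := by
  have hm := measurePreserving_add_right (volume : Measure ℝ) t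
  have h1 : eLpNorm (fun x => f (x + t)) p volume = eLpNorm f p volume :=
    eLpNorm_comp_measurePreserving hf.1 hm
  refine (eLpNorm_sub_le (hf.comp_measurePreserving hm).1 hf.1 hp).trans ?_
  rw [two_mul]
  exact add_le_add h1.le le_rfl

lemma rpow_lintegral_le_of_isProbabilityMeasure {α : Type*} [MeasurableSpace α] (μ : Measure α)
    [IsProbabilityMeasure μ] {r : ℝ} (hr : 1 ≤ r) {g : α → ℝ≥0∞} (hg : AEMeasurable g μ) :
    (∫⁻ a, g a ∂μ) ^ r ≤ ∫⁻ a, g a ^ r ∂μ := by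
  have h0 : 0 < r := zero_lt_one.trans_le hr
  rcases hr.eq_or_lt with rfl | hr'
  · simp
  have h := ENNReal.lintegral_mul_le_Lp_mul_Lq μ (Real.HolderConjugate.conjExponent hr') hg
    (g := fun _ => 1) aemeasurable_const
  simp only [Pi.mul_apply, mul_one, ENNReal.one_rpow, lintegral_const, measure_univ] at h
  calc (∫⁻ a, g a ∂μ) ^ r ≤ ((∫⁻ a, g a ^ r ∂μ) ^ (1 / r)) ^ r := by gcongr
    _ = _ := by rw [← ENNReal.rpow_mul, one_div, inv_mul_cancel₀ h0.ne', ENNReal.rpow_one]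

lemma measurable_poissonOsc_integrand (hf : StronglyMeasurable f) (y : ℝ) :
    Measurable fun q : ℝ × ℝ => ‖f (q.1 + y * q.2) - f q.1‖ₑ :=
  ((hf.comp_measurable (by fun_prop)).sub (hf.comp_measurable measurable_fst)).enorm

/-- The Poisson oscillation of an `L^p` function tends to zero in `L^p`: by Jensen's inequality it
is controlled by a Poisson average of the moduli `‖f (· + t) - f‖_p`, which are small for
small `t`. -/
lemma tendsto_eLpNorm_poissonOsc (hp : 1 ≤ p) (hp_top : p ≠ ∞) (hf : MemLp f p volume)
    (hfm : StronglyMeasurable f) :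
    Tendsto (fun y : ℝ => eLpNorm (poissonOsc f y) p volume) (𝓝[>] 0) (𝓝 0) := by
  set κ := ProbabilityTheory.cauchyMeasure 0 1
  have hp0 : p ≠ 0 := (zero_lt_one.trans_le hp).ne'
  have hr : 1 ≤ p.toReal := by
    simpa using ENNReal.toReal_mono hp_top hp
  have hr0 : 0 < p.toReal := zero_lt_one.trans_le hr
  set ω : ℝ → ℝ≥0∞ := fun t => (eLpNorm (fun x => f (x + t) - f x) p volume) ^ p.toReal
  have hω : ∀ t, ω t = ∫⁻ x, ‖f (x + t) - f x‖ₑ ^ p.toReal := fun t => by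
    simp only [ω, eLpNorm_eq_lintegral_rpow_enorm_toReal hp0 hp_top]
    rw [← ENNReal.rpow_mul, one_div, inv_mul_cancel₀ hr0.ne', ENNReal.rpow_one]
  have hω0 : Tendsto ω (𝓝 0) (𝓝 0) := by
    have := (ENNReal.continuous_rpow_const (y := p.toReal)).tendsto 0 |>.comp
      (tendsto_eLpNorm_translate hp hp_top hf)
    rwa [ENNReal.zero_rpow_of_pos hr0] at this
  have hωb : ∀ t, ω t ≤ (2 * eLpNorm f p volume) ^ p.toReal := fun t =>
    ENNReal.rpow_le_rpow (eLpNorm_translate_le hp hf t) hr0.le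
  have hωm : Measurable ω := by
    rw [show ω = _ from funext hω]
    have : Measurable fun q : ℝ × ℝ => ‖f (q.2 + q.1) - f q.2‖ₑ ^ p.toReal :=
      ((hfm.comp_measurable (by fun_prop)).sub
        (hfm.comp_measurable measurable_snd)).enorm.pow_const _
    exact this.lintegral_prod_right'
  have hbound : ∀ y, eLpNorm (poissonOsc f y) p volume ≤ (∫⁻ s, ω (y * s) ∂κ) ^ (1 / p.toReal) := by
    intro y
    rw [eLpNorm_eq_lintegral_rpow_enorm_toReal hp0 hp_top]
    refine ENNReal.rpow_le_rpow ?_ (by positivity)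
    calc ∫⁻ x, ‖poissonOsc f y x‖ₑ ^ p.toReal
        ≤ ∫⁻ x, ∫⁻ s, ‖f (x + y * s) - f x‖ₑ ^ p.toReal ∂κ := by
          refine lintegral_mono fun x => ?_
          rw [enorm_eq_self]
          exact rpow_lintegral_le_of_isProbabilityMeasure κ hr
            ((measurable_poissonOsc_integrand hfm y).comp measurable_prodMk_left).aemeasurable
      _ = ∫⁻ s, ω (y * s) ∂κ := by
          rw [lintegral_lintegral_swap
            ((measurable_poissonOsc_integrand hfm y).pow_const _).aemeasurable]
          simp_rw [hω]
  have hlim : Tendsto (fun y : ℝ => ∫⁻ s, ω (y * s) ∂κ) (𝓝[>] 0) (𝓝 (∫⁻ _, 0 ∂κ)) := by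
    refine tendsto_lintegral_filter_of_dominated_convergence
      (fun _ => (2 * eLpNorm f p volume) ^ p.toReal) ?_ ?_ ?_ ?_
    · exact .of_forall fun y => hωm.comp (measurable_const_mul y)
    · exact .of_forall fun y => .of_forall fun s => hωb _
    · rw [lintegral_const, measure_univ, mul_one]
      exact ENNReal.rpow_ne_top_of_nonneg hr0.le
        (ENNReal.mul_ne_top ENNReal.ofNat_ne_top hf.2.ne)
    · refine .of_forall fun s => hω0.comp ?_
      have : Tendsto (fun y : ℝ => y * s) (𝓝 0) (𝓝 (0 * s)) := by
        exact (continuous_mul_const s).tendsto 0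
      rw [zero_mul] at this
      exact this.mono_left nhdsWithin_le_nhds
  rw [lintegral_zero] at hlim
  have h2 := (ENNReal.continuous_rpow_const (y := 1 / p.toReal)).tendsto 0 |>.comp hlim
  rw [ENNReal.zero_rpow_of_pos (by positivity)] at h2
  exact tendsto_of_tendsto_of_tendsto_of_le_of_le tendsto_const_nhds h2 (fun _ => zero_le) hbound

/-- The mean of `‖f - f x‖` over the closed interval of radius `r` about `x`. -/
noncomputable def meanOsc (f : ℝ → E) (x r : ℝ) : ℝ≥0∞ :=
  (∫⁻ t in Metric.closedBall x r, ‖f t - f x‖ₑ) / volume (Metric.closedBall x r)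

lemma ae_tendsto_meanOsc (hp : 1 ≤ p) (hf : MemLp f p volume) :
    ∀ᵐ x, Tendsto (meanOsc f x) (𝓝[>] 0) (𝓝 0) := by
  filter_upwards [(Besicovitch.vitaliFamily (volume : Measure ℝ)).ae_tendsto_lintegral_enorm_sub_div
    (hf.locallyIntegrable hp)] with x hx
  exact hx.comp (Besicovitch.tendsto_filterAt volume x)

lemma meanOsc_le (hp : 1 ≤ p) (hp_top : p ≠ ∞) (f : ℝ → E) (x : ℝ) {r₀ r : ℝ} (h0 : 0 < r₀)
    (hr : r₀ ≤ r) :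
    meanOsc f x r ≤ 1 + ‖f x‖ₑ + eLpNorm f p volume ^ p.toReal / ENNReal.ofReal (2 * r₀) := by
  have hp0 : p ≠ 0 := (zero_lt_one.trans_le hp).ne'
  have hq : 1 ≤ p.toReal := by
    simpa using ENNReal.toReal_mono hp_top hp
  have hv : volume (Metric.closedBall x r) = ENNReal.ofReal (2 * r) := Real.volume_closedBall x r
  have hv0 : volume (Metric.closedBall x r) ≠ 0 := by
    rw [hv]; simp; linarith
  have hvt : volume (Metric.closedBall x r) ≠ ∞ := hv ▸ ENNReal.ofReal_ne_top
  have hN : eLpNorm f p volume ^ p.toReal = ∫⁻ t, ‖f t‖ₑ ^ p.toReal := by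
    rw [eLpNorm_eq_lintegral_rpow_enorm_toReal hp0 hp_top, ← ENNReal.rpow_mul, one_div,
      inv_mul_cancel₀ (zero_lt_one.trans_le hq).ne', ENNReal.rpow_one]
  unfold meanOsc
  have h1 : ∫⁻ t in Metric.closedBall x r, ‖f t - f x‖ₑ ≤
      (1 + ‖f x‖ₑ) * volume (Metric.closedBall x r) + eLpNorm f p volume ^ p.toReal := by
    calc _ ≤ ∫⁻ t in Metric.closedBall x r, ((1 + ‖f x‖ₑ) + ‖f t‖ₑ ^ p.toReal) := by
          refine lintegral_mono fun t => ?_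
          refine enorm_sub_le.trans ?_
          -- This replaces Hölder's inequality; only finiteness of the bound matters.
          have : ‖f t‖ₑ ≤ 1 + ‖f t‖ₑ ^ p.toReal := by
            rcases le_total ‖f t‖ₑ 1 with h | h
            · exact h.trans le_self_add
            · refine le_trans ?_ le_add_self
              simpa using ENNReal.rpow_le_rpow_of_exponent_le h hq
          calc ‖f t‖ₑ + ‖f x‖ₑ ≤ (1 + ‖f t‖ₑ ^ p.toReal) + ‖f x‖ₑ := by gcongr
            _ = _ := by ring
      _ = (1 + ‖f x‖ₑ) * volume (Metric.closedBall x r)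
            + ∫⁻ t in Metric.closedBall x r, ‖f t‖ₑ ^ p.toReal := by
          rw [lintegral_add_left measurable_const, setLIntegral_const]
      _ ≤ _ := by
          rw [hN]
          exact add_le_add_right (setLIntegral_le_lintegral _ _) _
  calc _ ≤ ((1 + ‖f x‖ₑ) * volume (Metric.closedBall x r) + eLpNorm f p volume ^ p.toReal)
        / volume (Metric.closedBall x r) := by gcongr
    _ ≤ _ := by
      rw [ENNReal.add_div, ENNReal.mul_div_cancel_right hv0 hvt, hv]
      gcongr

/-- The Poisson oscillation is dominated by the means over the dyadic dilates of an interval. -/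
lemma poissonOsc_le_tsum (hf : StronglyMeasurable f) (x : ℝ) {y : ℝ} (hy : 0 < y) :
    poissonOsc f y x ≤ ∑' k : ℕ, 8 * (2⁻¹ : ℝ≥0∞) ^ k * meanOsc f x (2 ^ k * y) := by
  have hm : Measurable fun s => ‖f (x + y * s) - f x‖ₑ :=
    (measurable_poissonOsc_integrand hf y).comp measurable_prodMk_left
  have hker : ∀ s : ℝ, ENNReal.ofReal (Real.pi⁻¹ * (1 + s ^ 2)⁻¹) ≤
      ∑' k : ℕ, (Metric.closedBall (0 : ℝ) (2 ^ k)).indicator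
        (fun _ => (4 * (4⁻¹ : ℝ≥0∞) ^ k)) s := by
    intro s
    obtain ⟨n, hn⟩ : ∃ n : ℕ, |s| ≤ 2 ^ n := by
      obtain ⟨n, hn⟩ := pow_unbounded_of_one_lt |s| (one_lt_two)
      exact ⟨n, hn.le⟩
    classical
    have hex : ∃ n : ℕ, |s| ≤ 2 ^ n := ⟨n, hn⟩
    -- For the least `k` with `|s| ≤ 2 ^ k`, either `k = 0` or `|s| > 2 ^ (k - 1)`.
    let k := Nat.find hex
    have hk : |s| ≤ 2 ^ k := Nat.find_spec hex
    refine le_trans ?_ (ENNReal.le_tsum k)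
    rw [Set.indicator_of_mem (by simpa using hk)]
    have hpi : Real.pi⁻¹ ≤ 1 := inv_le_one_of_one_le₀ (by linarith [Real.pi_gt_three])
    have hb : Real.pi⁻¹ * (1 + s ^ 2)⁻¹ ≤ 4 * (4⁻¹ : ℝ) ^ k := by
      have hs0 : 0 ≤ (1 + s ^ 2)⁻¹ := by positivity
      refine (mul_le_of_le_one_left hs0 hpi).trans ?_
      rcases Nat.eq_zero_or_pos k with h0 | h0
      · rw [h0, pow_zero]
        exact (inv_le_one_of_one_le₀ (by nlinarith)).trans (by norm_num)
      · obtain ⟨j, hj⟩ := Nat.exists_eq_succ_of_ne_zero h0.ne'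
        have hlt : (2 : ℝ) ^ j < |s| := by
          have := Nat.find_min hex (m := j)
            (by change j < k; omega)
          exact not_le.1 this
        rw [hj]
        have h4 : (4 : ℝ) ^ j ≤ 1 + s ^ 2 := by
          have : ((2 : ℝ) ^ j) ^ 2 ≤ |s| ^ 2 := by gcongr
          rw [sq_abs, ← pow_mul, mul_comm, pow_mul] at this
          norm_num at this; linarith
        calc (1 + s ^ 2)⁻¹ ≤ ((4 : ℝ) ^ j)⁻¹ := inv_anti₀ (by positivity) h4
          _ = _ := by rw [← inv_pow, Nat.succ_eq_add_one, pow_succ]; ring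
    calc ENNReal.ofReal (Real.pi⁻¹ * (1 + s ^ 2)⁻¹) ≤ ENNReal.ofReal (4 * (4⁻¹ : ℝ) ^ k) :=
          ENNReal.ofReal_le_ofReal hb
      _ = _ := by
          rw [ENNReal.ofReal_mul (by norm_num), ENNReal.ofReal_pow (by norm_num),
            ENNReal.ofReal_inv_of_pos (by norm_num)]
          norm_num
  have hball : ∀ k : ℕ, ∫⁻ s in Metric.closedBall (0 : ℝ) (2 ^ k), ‖f (x + y * s) - f x‖ₑ =
      2 * 2 ^ k * meanOsc f x (2 ^ k * y) := by
    intro k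
    have hR : (0 : ℝ) < 2 ^ k * y := by positivity
    have hcv : ∫⁻ t in Metric.closedBall x (2 ^ k * y), ‖f t - f x‖ₑ =
        ENNReal.ofReal y * ∫⁻ s in Metric.closedBall (0 : ℝ) (2 ^ k), ‖f (x + y * s) - f x‖ₑ := by
      have himg : (fun s => x + y * s) '' Metric.closedBall (0 : ℝ) (2 ^ k) =
          Metric.closedBall x (2 ^ k * y) := by
        ext t
        simp only [Set.mem_image, Metric.mem_closedBall, dist_zero_right, Real.norm_eq_abs,
          Real.dist_eq]
        constructor
        · rintro ⟨s, hs, rfl⟩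
          rw [add_sub_cancel_left, abs_mul, abs_of_pos hy, mul_comm]
          gcongr
        · intro ht
          refine ⟨(t - x) / y, ?_, by field_simp; ring⟩
          rwa [abs_div, abs_of_pos hy, div_le_iff₀ hy]
      have := lintegral_image_eq_lintegral_abs_deriv_mul (s := Metric.closedBall (0 : ℝ) (2 ^ k))
        (f := fun s => x + y * s) (f' := fun _ => y) Metric.isClosed_closedBall.measurableSet
        (fun s _ => by
          simpa using (((hasDerivAt_id s).const_mul y).const_add x).hasDerivWithinAt)
        (fun a _ b _ hab => by
          have : y * a = y * b := by simpa using hab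
          exact mul_left_cancel₀ hy.ne' this)
        (fun t => ‖f t - f x‖ₑ)
      rw [himg] at this
      rw [this, lintegral_const_mul _ hm, abs_of_pos hy]
    unfold meanOsc
    rw [hcv, Real.volume_closedBall]
    have h1 : ENNReal.ofReal (2 * (2 ^ k * y)) = 2 * 2 ^ k * ENNReal.ofReal y := by
      rw [← mul_assoc, ENNReal.ofReal_mul (by positivity), ENNReal.ofReal_mul (by norm_num),
        ENNReal.ofReal_pow (by norm_num)]
      norm_num
    rw [h1]
    have hy0 : ENNReal.ofReal y ≠ 0 := by simpa using hy
    have h2 : (2 * 2 ^ k : ℝ≥0∞) ≠ 0 := by positivity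
    have h3 : (2 * 2 ^ k : ℝ≥0∞) ≠ ∞ := by finiteness
    rw [mul_comm (2 * 2 ^ k : ℝ≥0∞) (ENNReal.ofReal y),
      ENNReal.mul_div_mul_left _ _ hy0 ENNReal.ofReal_ne_top, ENNReal.mul_div_cancel h2 h3]
  unfold poissonOsc
  rw [lintegral_cauchyMeasure _ hm]
  calc _ ≤ ∫⁻ s, ∑' k : ℕ, (Metric.closedBall (0 : ℝ) (2 ^ k)).indicator
        (fun s => (4 * (4⁻¹ : ℝ≥0∞) ^ k) * ‖f (x + y * s) - f x‖ₑ) s := by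
        refine lintegral_mono fun s => ?_
        refine (mul_le_mul_left (hker s) _).trans ?_
        rw [← ENNReal.tsum_mul_right]
        refine ENNReal.tsum_le_tsum fun k => ?_
        by_cases hs : s ∈ Metric.closedBall (0 : ℝ) (2 ^ k)
        · simp only [Set.indicator_of_mem hs]; exact le_rfl
        · simp only [Set.indicator_of_notMem hs, zero_mul]; exact le_rfl
    _ = ∑' k : ℕ, (4 * (4⁻¹ : ℝ≥0∞) ^ k) *
          ∫⁻ s in Metric.closedBall (0 : ℝ) (2 ^ k), ‖f (x + y * s) - f x‖ₑ := by
        rw [lintegral_tsum fun k => ((hm.const_mul _).indicator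
          Metric.isClosed_closedBall.measurableSet).aemeasurable]
        refine tsum_congr fun k => ?_
        rw [lintegral_indicator Metric.isClosed_closedBall.measurableSet, lintegral_const_mul _ hm]
    _ = _ := by
        refine tsum_congr fun k => ?_
        rw [hball]
        have h4 : (4⁻¹ : ℝ≥0∞) ^ k * 2 ^ k = 2⁻¹ ^ k := by
          rw [← mul_pow]
          congr 1
          rw [show (4 : ℝ≥0∞) = 2 * 2 by norm_num, ENNReal.mul_inv (by simp) (by simp), mul_assoc,
            ENNReal.inv_mul_cancel (by simp) (by simp), mul_one]
        calc 4 * 4⁻¹ ^ k * (2 * 2 ^ k * meanOsc f x (2 ^ k * y))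
            = 8 * (4⁻¹ ^ k * 2 ^ k) * meanOsc f x (2 ^ k * y) := by ring
          _ = _ := by rw [h4]

/-- The Poisson oscillation tends to zero at every Lebesgue point, hence almost everywhere. -/
lemma ae_tendsto_poissonOsc (hp : 1 ≤ p) (hp_top : p ≠ ∞) (hf : MemLp f p volume)
    (hfm : StronglyMeasurable f) :
    ∀ᵐ x, Tendsto (fun y => poissonOsc f y x) (𝓝[>] 0) (𝓝 0) := by
  filter_upwards [ae_tendsto_meanOsc hp hf] with x hx
  obtain ⟨C, hC, hM⟩ : ∃ C : ℝ≥0∞, C ≠ ∞ ∧ ∀ r : ℝ, 0 < r → meanOsc f x r ≤ C := by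
    have h1 : ∀ᶠ r in 𝓝[>] (0 : ℝ), meanOsc f x r < 1 :=
      (tendsto_order.1 hx).2 1 one_pos
    obtain ⟨r₀, hr₀, h⟩ := mem_nhdsGT_iff_exists_Ioc_subset.1 h1
    have hr₀' : (0 : ℝ) < r₀ := hr₀
    refine ⟨1 + ‖f x‖ₑ + eLpNorm f p volume ^ p.toReal / ENNReal.ofReal (2 * r₀), ?_, ?_⟩
    · have : eLpNorm f p volume ^ p.toReal ≠ ∞ :=
        ENNReal.rpow_ne_top_of_nonneg ENNReal.toReal_nonneg hf.2.ne
      have h2 : ENNReal.ofReal (2 * r₀) ≠ 0 := by simpa using hr₀'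
      have h3 : ‖f x‖ₑ ≠ ∞ := enorm_ne_top
      exact ENNReal.add_ne_top.2 ⟨ENNReal.add_ne_top.2 ⟨ENNReal.one_ne_top, h3⟩,
        ENNReal.div_ne_top this h2⟩
    · intro r hr
      rcases le_total r r₀ with hle | hle
      · exact (h ⟨hr, hle⟩).le.trans (le_self_add.trans le_self_add)
      · exact meanOsc_le hp hp_top f x hr₀' hle
  have hlim : Tendsto (fun y : ℝ => ∫⁻ k : ℕ, 8 * (2⁻¹ : ℝ≥0∞) ^ k * meanOsc f x (2 ^ k * y)
      ∂Measure.count) (𝓝[>] 0) (𝓝 (∫⁻ _ : ℕ, 0 ∂Measure.count)) := by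
    refine tendsto_lintegral_filter_of_dominated_convergence
      (fun k => 8 * (2⁻¹ : ℝ≥0∞) ^ k * C) ?_ ?_ ?_ ?_
    · exact .of_forall fun y => measurable_from_nat
    · filter_upwards [self_mem_nhdsWithin] with y hy
      refine .of_forall fun k => ?_
      have hy' : (0 : ℝ) < y := hy
      gcongr
      exact hM _ (by positivity)
    · rw [lintegral_count, ENNReal.tsum_mul_right, ENNReal.tsum_mul_left, ENNReal.tsum_geometric]
      refine ENNReal.mul_ne_top (ENNReal.mul_ne_top (by simp) ?_) hC
      simp
    · refine .of_forall fun k => ?_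
      have h2 : Tendsto (fun y : ℝ => 2 ^ k * y) (𝓝[>] 0) (𝓝[>] 0) := by
        refine tendsto_nhdsWithin_iff.2 ⟨?_, ?_⟩
        · have : Tendsto (fun y : ℝ => 2 ^ k * y) (𝓝 0) (𝓝 (2 ^ k * 0)) :=
            (continuous_const_mul _).tendsto 0
          rw [mul_zero] at this
          exact this.mono_left nhdsWithin_le_nhds
        · filter_upwards [self_mem_nhdsWithin] with y hy
          have hy' : (0 : ℝ) < y := hy
          exact Set.mem_Ioi.2 (by positivity)
      have h3 := ENNReal.Tendsto.const_mul (a := 8 * (2⁻¹ : ℝ≥0∞) ^ k) (hx.comp h2)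
        (Or.inr (by finiteness))
      simpa using h3
  simp only [lintegral_zero, lintegral_count] at hlim
  refine tendsto_of_tendsto_of_tendsto_of_le_of_le' tendsto_const_nhds hlim
    (.of_forall fun _ => zero_le) ?_
  filter_upwards [self_mem_nhdsWithin] with y hy
  exact poissonOsc_le_tsum hfm x hy

end Osc

/-! ### Integration of `L^p` functions against kernels of order `1 / |s|` -/

lemma memLp_inv_one_add_abs {q : ℝ≥0∞} (hq : 1 < q) (hq_top : q ≠ ∞) :
    MemLp (fun s : ℝ => (1 + |s|)⁻¹) q volume := by
  have hm : AEStronglyMeasurable (fun s : ℝ => (1 + |s|)⁻¹) volume :=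
    (by fun_prop : Measurable fun s : ℝ => (1 + |s|)⁻¹).aestronglyMeasurable
  have hq1 : 1 < q.toReal := by
    simpa using (ENNReal.toReal_lt_toReal ENNReal.one_ne_top hq_top).2 hq
  rw [← integrable_norm_rpow_iff hm (zero_lt_one.trans hq).ne' hq_top]
  have := integrable_one_add_norm (E := ℝ) (μ := volume) (r := q.toReal) (by simpa using hq1)
  refine this.congr (.of_forall fun s => ?_)
  have h : 0 < 1 + |s| := by positivity
  simp only [Real.norm_eq_abs]
  rw [abs_of_pos (inv_pos.2 h), Real.inv_rpow h.le, Real.rpow_neg h.le]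

section Kernel

variable {𝕜 E : Type*} [RCLike 𝕜] [NormedAddCommGroup E] [NormedSpace 𝕜 E] {p : ℝ≥0∞}
  {k : ℝ → 𝕜} {f : ℝ → E} {C : ℝ}

lemma one_lt_conjExponent (hp : 1 < p) (hp_top : p ≠ ∞) : 1 < ENNReal.conjExponent p := by
  have := ENNReal.HolderConjugate.conjExponent hp.le
  exact (ENNReal.HolderConjugate.lt_top_iff_one_lt p _).1 hp_top.lt_top

lemma conjExponent_ne_top (hp : 1 < p) : ENNReal.conjExponent p ≠ ∞ := by
  have := ENNReal.HolderConjugate.conjExponent hp.le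
  exact ((ENNReal.HolderConjugate.lt_top_iff_one_lt _ p).2 hp).ne

lemma memLp_of_norm_le_inv_one_add_abs {q : ℝ≥0∞} (hq : 1 < q) (hq_top : q ≠ ∞)
    (hk : AEStronglyMeasurable k volume) (hkC : ∀ s, ‖k s‖ ≤ C * (1 + |s|)⁻¹) :
    MemLp k q volume :=
  ((memLp_inv_one_add_abs hq hq_top).const_mul C).mono' hk (.of_forall hkC)

lemma lintegral_enorm_smul_le (hp : 1 ≤ p) (hk : AEStronglyMeasurable k volume)
    (hf : AEStronglyMeasurable f volume) :
    ∫⁻ s, ‖k s • f s‖ₑ ≤ eLpNorm k (ENNReal.conjExponent p) volume * eLpNorm f p volume := by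
  have := ENNReal.HolderConjugate.conjExponent hp
  rw [← eLpNorm_one_eq_lintegral_enorm]
  exact eLpNorm_smul_le_mul_eLpNorm hf hk

lemma integrable_kernel_smul (hp : 1 < p) (hp_top : p ≠ ∞) (hf : MemLp f p volume)
    (hk : AEStronglyMeasurable k volume) (hkC : ∀ s, ‖k s‖ ≤ C * (1 + |s|)⁻¹) :
    Integrable (fun s => k s • f s) := by
  have := ENNReal.HolderConjugate.conjExponent hp.le
  rw [← memLp_one_iff_integrable]
  exact hf.smul (memLp_of_norm_le_inv_one_add_abs (one_lt_conjExponent hp hp_top)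
    (conjExponent_ne_top hp) hk hkC)

lemma tendsto_integral_kernel_smul [NormedSpace ℝ E] {ι : Type*} {l : Filter ι} {F : ι → ℝ → E}
    (hp : 1 < p) (hp_top : p ≠ ∞) (hF : ∀ᶠ i in l, MemLp (F i) p volume) (hf : MemLp f p volume)
    (hlim : Tendsto (fun i => eLpNorm (fun s => F i s - f s) p volume) l (𝓝 0))
    (hk : AEStronglyMeasurable k volume) (hkC : ∀ s, ‖k s‖ ≤ C * (1 + |s|)⁻¹) :
    Tendsto (fun i => ∫ s, k s • F i s) l (𝓝 (∫ s, k s • f s)) := by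
  have hkq := memLp_of_norm_le_inv_one_add_abs (one_lt_conjExponent hp hp_top)
    (conjExponent_ne_top hp) hk hkC
  refine tendsto_integral_of_L1 _ (integrable_kernel_smul hp hp_top hf hk hkC).1
    (hF.mono fun i hi => integrable_kernel_smul hp hp_top hi hk hkC) ?_
  have h1 := ENNReal.Tendsto.const_mul (a := eLpNorm k (ENNReal.conjExponent p) volume) hlim
    (Or.inr hkq.2.ne)
  rw [mul_zero] at h1
  refine tendsto_of_tendsto_of_tendsto_of_le_of_le' tendsto_const_nhds h1
    (.of_forall fun _ => zero_le) (hF.mono fun i hi => ?_)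
  simp_rw [← smul_sub]
  exact lintegral_enorm_smul_le hp.le hk (hi.sub hf).1

end Kernel

section Affine

variable {E : Type*} [NormedAddCommGroup E] {p : ℝ≥0∞} {f : ℝ → E}

lemma memLp_comp_affine (hf : MemLp f p volume) (x : ℝ) {y : ℝ} (hy : y ≠ 0) :
    MemLp (fun s => f (x + y * s)) p volume := by
  have h1 : MemLp (fun s => f (x + s)) p volume :=
    hf.comp_measurePreserving (measurePreserving_add_left volume x)
  have hmap := Real.map_volume_mul_left hy
  have h2 : MemLp (fun s => f (x + s)) p (Measure.map (fun s => y * s) volume) := by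
    rw [hmap]
    exact h1.smul_measure ENNReal.ofReal_ne_top
  exact (memLp_map_measure_iff h2.1 (by fun_prop)).1 h2

lemma integral_kernel_comp_affine [NormedSpace ℝ E] (k : ℝ → ℝ) (f : ℝ → E) (x : ℝ) {y : ℝ}
    (hy : 0 < y) :
    ∫ s, k s • f (x + y * s) = ∫ t, (y⁻¹ * k ((t - x) / y)) • f t := by
  have h1 := Measure.integral_comp_mul_left (fun u => k (u / y) • f (x + u)) y
  simp only [mul_div_cancel_left₀ _ hy.ne'] at h1
  rw [h1, abs_of_pos (inv_pos.2 hy), ← integral_smul,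
    ← integral_add_left_eq_self (fun t => (y⁻¹ * k ((t - x) / y)) • f t) x]
  simp only [add_sub_cancel_left, mul_smul]

end Affine

section Approx

variable {E : Type*} [NormedAddCommGroup E] [NormedSpace ℝ E] {p : ℝ≥0∞}
  {f : ℝ → E} {k : ℝ → ℝ} {C : ℝ}

lemma inv_one_add_sq_le (s : ℝ) : (1 + s ^ 2)⁻¹ ≤ 2 * (1 + |s|)⁻¹ := by
  rw [← div_eq_mul_inv, le_div_iff₀ (by positivity), inv_mul_le_iff₀ (by positivity)]
  nlinarith [sq_nonneg (|s| - 1), sq_abs s, abs_nonneg s]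

lemma integrable_of_abs_le_inv_one_add_sq (hk : Measurable k)
    (hkC : ∀ s, |k s| ≤ C * (1 + s ^ 2)⁻¹) : Integrable k :=
  (integrable_inv_one_add_sq.const_mul C).mono' hk.aestronglyMeasurable (.of_forall hkC)

lemma integrable_dilate (hp : 1 < p) (hp_top : p ≠ ∞) (hf : MemLp f p volume) (hk : Measurable k)
    (hkC : ∀ s, |k s| ≤ C * (1 + |s|)⁻¹) (x : ℝ) {y : ℝ} (hy : y ≠ 0) :
    Integrable fun s => k s • f (x + y * s) :=
  integrable_kernel_smul hp hp_top (memLp_comp_affine hf x hy) hk.aestronglyMeasurable hkC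

/-- A kernel dominated by the Poisson kernel reproduces its total mass up to the Poisson
oscillation. -/
lemma enorm_integral_dilate_sub_le [CompleteSpace E] (hp : 1 < p) (hp_top : p ≠ ∞) (hf : MemLp f p volume)
    (hfm : StronglyMeasurable f) (hk : Measurable k) (hkC : ∀ s, |k s| ≤ C * (1 + s ^ 2)⁻¹)
    (x : ℝ) {y : ℝ} (hy : y ≠ 0) :
    ‖(∫ s, k s • f (x + y * s)) - (∫ s, k s) • f x‖ₑ ≤
      ENNReal.ofReal (Real.pi * C) * poissonOsc f y x := by
  have hC : 0 ≤ C := by simpa using (abs_nonneg _).trans (hkC 0)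
  have hi := integrable_dilate hp hp_top hf hk (C := C * 2)
    (fun s => (hkC s).trans (by
      rw [mul_assoc]; exact mul_le_mul_of_nonneg_left (inv_one_add_sq_le s) hC)) x hy
  rw [← integral_smul_const, ← integral_sub hi
    ((integrable_of_abs_le_inv_one_add_sq hk hkC).smul_const _)]
  simp_rw [← smul_sub]
  refine (enorm_integral_le_lintegral_enorm _).trans ?_
  have hm : Measurable fun s => ‖f (x + y * s) - f x‖ₑ :=
    (measurable_poissonOsc_integrand hfm y).comp measurable_prodMk_left
  rw [poissonOsc, lintegral_cauchyMeasure _ hm, ← lintegral_const_mul _ (by fun_prop)]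
  refine lintegral_mono fun s => ?_
  dsimp only
  rw [enorm_smul, ← mul_assoc, ← ENNReal.ofReal_mul (by positivity)]
  gcongr
  rw [Real.enorm_eq_ofReal_abs]
  refine ENNReal.ofReal_le_ofReal ((hkC s).trans (le_of_eq ?_))
  field_simp

end Approx

/-! ### Cauchy's formula on horizontal lines -/

open Complex in
/-- Cauchy's theorem for an infinite strip. Integrability over the two ends of the strip provides
vertical sides `Re w = ± R`, with `R` arbitrarily large, along which the integral is small. -/
lemma integral_line_eq {G : ℂ → ℂ} {a b R₀ : ℝ} (hab : a ≤ b)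
    (hG : DifferentiableOn ℂ G {w | a ≤ w.im})
    (ha : Integrable fun t : ℝ => G (t + a * I)) (hb : Integrable fun t : ℝ => G (t + b * I))
    (hs : ∫⁻ y in Set.Icc a b, ∫⁻ t in {t : ℝ | R₀ ≤ |t|}, ‖G (t + y * I)‖ₑ < ∞) :
    ∫ t : ℝ, G (t + a * I) = ∫ t : ℝ, G (t + b * I) := by
  set S := {t : ℝ | R₀ ≤ |t|}
  have hS : MeasurableSet S := measurableSet_le measurable_const (by fun_prop)
  -- Clamping the height at `a` makes the integrand continuous on the whole plane.
  let H : ℝ → ℝ → ℂ := fun t y => G (t + (max a y : ℝ) * I)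
  have hH : Continuous (Function.uncurry H) := by
    refine hG.continuousOn.comp_continuous (by fun_prop) fun q => ?_
    simp
  have hHeq : ∀ t : ℝ, ∀ y ∈ Set.Icc a b, H t y = G (t + y * I) := fun t y hy => by
    simp only [H]
    rw [max_eq_right hy.1]
  let g : ℝ → ℝ≥0∞ := fun t => ∫⁻ y in Set.Icc a b, ‖H t y‖ₑ
  have hgm : Measurable g := hH.measurable.enorm.lintegral_prod_right'
  have hgS : ∫⁻ t in S, g t < ∞ := by
    rw [lintegral_lintegral_swap hH.measurable.enorm.aemeasurable]
    rwa [setLIntegral_congr_fun measurableSet_Icc fun y hy => lintegral_congr fun t => by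
      rw [hHeq t y hy]]
  have hgS' : ∫⁻ t in S, g (-t) < ∞ := by
    have h1 := (Measure.measurePreserving_neg (volume : Measure ℝ)).setLIntegral_comp_preimage hS hgm
    have h2 : Neg.neg ⁻¹' S = S := by ext t; simp [S]
    rw [h2] at h1
    rwa [h1]
  have hfreq : ∀ η : ℝ≥0∞, 0 < η → ∃ᶠ R in atTop, g R + g (-R) < η := by
    intro η hη hev
    obtain ⟨R₁, hR₁⟩ := eventually_atTop.1 hev
    have hsub : Set.Ioi (max R₀ R₁) ⊆ S := fun t ht =>
      (le_of_lt (lt_of_le_of_lt (le_max_left _ _) ht)).trans (le_abs_self t)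
    have h1 : ∫⁻ t in Set.Ioi (max R₀ R₁), η ≤ ∫⁻ t in Set.Ioi (max R₀ R₁), (g t + g (-t)) :=
      setLIntegral_mono' measurableSet_Ioi fun t ht =>
        not_lt.1 (hR₁ t (le_of_lt (lt_of_le_of_lt (le_max_right _ _) ht)))
    have h2 : ∫⁻ t in Set.Ioi (max R₀ R₁), (g t + g (-t)) ≤ ∫⁻ t in S, (g t + g (-t)) :=
      lintegral_mono_set hsub
    rw [lintegral_add_left hgm (μ := volume.restrict S)] at h2
    rw [setLIntegral_const, Real.volume_Ioi, ENNReal.mul_top hη.ne'] at h1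
    exact absurd (h1.trans h2) (not_le.2 (ENNReal.add_lt_top.2 ⟨hgS, hgS'⟩))
  have hside : ∀ R : ℝ, ‖∫ y in a..b, G (R + y * I)‖ₑ ≤ g R := by
    intro R
    rw [intervalIntegral.integral_of_le hab]
    refine (enorm_integral_le_lintegral_enorm _).trans ?_
    rw [setLIntegral_congr_fun measurableSet_Ioc fun y hy => by
      rw [← hHeq R y (Set.Ioc_subset_Icc_self hy)]]
    exact lintegral_mono_set Set.Ioc_subset_Icc_self
  have hrect : ∀ R : ℝ, ‖(∫ t in -R..R, G (t + a * I)) - ∫ t in -R..R, G (t + b * I)‖ₑ ≤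
      g R + g (-R) := by
    intro R
    have h := integral_boundary_rect_eq_zero_of_differentiableOn G ⟨-R, a⟩ ⟨R, b⟩
      (hG.mono fun w hw => by
        rw [mem_reProdIm] at hw
        have := hw.2
        rw [Set.uIcc_of_le hab] at this
        exact this.1)
    dsimp only at h
    have h' : (∫ t in -R..R, G (t + a * I)) - ∫ t in -R..R, G (t + b * I) =
        I • (∫ y in a..b, G ((-R : ℝ) + y * I)) - I • ∫ y in a..b, G (R + y * I) := by
      linear_combination h
    have hI : ‖I‖ₑ = 1 := by rw [← ofReal_norm, norm_I, ENNReal.ofReal_one]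
    rw [h', add_comm (g R)]
    refine enorm_sub_le.trans (add_le_add ?_ ?_)
    · rw [enorm_smul, hI, one_mul]
      simpa using hside (-R)
    · rw [enorm_smul, hI, one_mul]
      simpa using hside R
  have hlim := ((intervalIntegral_tendsto_integral ha tendsto_neg_atTop_atBot tendsto_id).sub
    (intervalIntegral_tendsto_integral hb tendsto_neg_atTop_atBot tendsto_id)).enorm
  rw [← sub_eq_zero, ← enorm_eq_zero]
  by_contra hne
  have hev := hlim.eventually (lt_mem_nhds (ENNReal.half_lt_self hne enorm_ne_top))
  obtain ⟨R, hR, hR'⟩ := ((hfreq _ (ENNReal.half_pos hne)).and_eventually hev).exists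
  exact absurd ((hR'.trans_le (hrect R)).trans hR) (lt_irrefl _)

lemma norm_inv_sub_le {z : ℂ} {η y : ℝ} (hη : 0 < η) (hy : η ≤ |y - z.im|) (t : ℝ) :
    ‖((t : ℂ) + y * Complex.I - z)⁻¹‖ ≤ ((1 + |z.re|) / η + 1) * (1 + |t|)⁻¹ := by
  have h1 : |t - z.re| ≤ ‖(t : ℂ) + y * Complex.I - z‖ := by
    simpa using Complex.abs_re_le_norm ((t : ℂ) + y * Complex.I - z)
  have h2 : η ≤ ‖(t : ℂ) + y * Complex.I - z‖ := hy.trans (by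
    simpa using Complex.abs_im_le_norm ((t : ℂ) + y * Complex.I - z))
  have h3 : |t| ≤ |z.re| + |t - z.re| := by
    have := abs_add_le z.re (t - z.re); rwa [add_sub_cancel] at this
  rw [norm_inv, ← div_eq_mul_inv, inv_le_comm₀ (hη.trans_le h2) (by positivity), inv_div,
    div_le_iff₀ (by positivity)]
  have h4 : 1 + |z.re| ≤ ‖(t : ℂ) + y * Complex.I - z‖ * ((1 + |z.re|) / η) := by
    rw [← mul_div_assoc, le_div_iff₀ hη, mul_comm]
    gcongr
  linarith

lemma norm_inv_sub_le_of_le_abs {z : ℂ} {t : ℝ} (ht : |z.re| + 1 ≤ |t|) (y : ℝ) :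
    ‖((t : ℂ) + y * Complex.I - z)⁻¹‖ ≤ (|z.re| + 2) * (1 + |t|)⁻¹ := by
  have h1 : |t - z.re| ≤ ‖(t : ℂ) + y * Complex.I - z‖ := by
    simpa using Complex.abs_re_le_norm ((t : ℂ) + y * Complex.I - z)
  have h3 : |t| ≤ |z.re| + |t - z.re| := by
    have := abs_add_le z.re (t - z.re); rwa [add_sub_cancel] at this
  have h5 : 1 ≤ ‖(t : ℂ) + y * Complex.I - z‖ := by linarith
  rw [norm_inv, ← div_eq_mul_inv, inv_le_comm₀ (by linarith) (by positivity), inv_div,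
    div_le_iff₀ (by positivity)]
  nlinarith [abs_nonneg z.re]

lemma measurable_inv_sub (z : ℂ) (y : ℝ) :
    Measurable fun t : ℝ => ((t : ℂ) + y * Complex.I - z)⁻¹ := by fun_prop

/-- The Cauchy kernel tends to zero in `L^q` along horizontal lines moving up to infinity. -/
lemma tendsto_eLpNorm_inv_sub {q : ℝ≥0∞} (hq : 1 < q) (hq_top : q ≠ ∞) (z : ℂ) :
    Tendsto (fun b : ℝ => eLpNorm (fun t : ℝ => ((t : ℂ) + b * Complex.I - z)⁻¹) q volume)
      atTop (𝓝 0) := by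
  have hq0 : q ≠ 0 := (zero_lt_one.trans hq).ne'
  have hr : 0 < q.toReal := ENNReal.toReal_pos hq0 hq_top
  have hdom := (memLp_inv_one_add_abs hq hq_top).const_mul ((1 + |z.re|) / 1 + 1)
  have hdom' := lintegral_rpow_enorm_lt_top_of_eLpNorm_lt_top hq0 hq_top hdom.2
  have hlim : Tendsto (fun b : ℝ => ∫⁻ t : ℝ, ‖((t : ℂ) + b * Complex.I - z)⁻¹‖ₑ ^ q.toReal) atTop
      (𝓝 (∫⁻ _ : ℝ, 0)) := by
    refine tendsto_lintegral_filter_of_dominated_convergence _ ?_ ?_ hdom'.ne ?_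
    · exact .of_forall fun b => (measurable_inv_sub z b).enorm.pow_const _
    · filter_upwards [eventually_ge_atTop (z.im + 1)] with b hb
      refine .of_forall fun t => ?_
      refine ENNReal.rpow_le_rpow ?_ hr.le
      rw [enorm_le_iff_norm_le]
      refine (norm_inv_sub_le one_pos ?_ t).trans (le_abs_self _)
      rw [abs_of_nonneg (by linarith)]; linarith
    · refine .of_forall fun t => ?_
      have h1 : Tendsto (fun b : ℝ => (t : ℂ) + b * Complex.I - z) atTop (Bornology.cobounded ℂ) := by
        rw [← tendsto_norm_atTop_iff_cobounded]
        refine tendsto_atTop_mono (f := fun b : ℝ => b - z.im) (fun b => ?_)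
          (tendsto_atTop_add_const_right _ _ tendsto_id)
        refine (le_abs_self _).trans ?_
        simpa using Complex.abs_im_le_norm ((t : ℂ) + b * Complex.I - z)
      have h2 := (tendsto_inv₀_cobounded.comp h1).enorm
      have h3 := (ENNReal.continuous_rpow_const (y := q.toReal)).tendsto _ |>.comp h2
      simpa [Function.comp_def, ENNReal.zero_rpow_of_pos hr] using h3
  rw [lintegral_zero] at hlim
  have h2 := (ENNReal.continuous_rpow_const (y := 1 / q.toReal)).tendsto 0 |>.comp hlim
  rw [ENNReal.zero_rpow_of_pos (by positivity)] at h2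
  refine h2.congr fun b => ?_
  rw [eLpNorm_eq_lintegral_rpow_enorm_toReal hq0 hq_top]
  rfl

/-- If `G w = F w / (w - z)` is regular on the closed half-plane `Im w ≥ a` and `F` is bounded in
`L^p` there, then pushing the line of integration up to infinity shows that `G` has integral zero
along the boundary. -/
lemma integral_line_eq_zero {p : ℝ≥0∞} (hp : 1 < p) (hp_top : p ≠ ∞) {F G : ℂ → ℂ} {a : ℝ}
    {M : ℝ≥0∞} (hM : M ≠ ∞) {z : ℂ} (hza : z.im ≠ a)
    (hFm : ∀ y, a ≤ y → AEStronglyMeasurable (fun t : ℝ => F (t + y * Complex.I)) volume)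
    (hF : ∀ y, a ≤ y → eLpNorm (fun t : ℝ => F (t + y * Complex.I)) p volume ≤ M)
    (hG : DifferentiableOn ℂ G {w | a ≤ w.im})
    (hGF : ∀ w : ℂ, w ≠ z → G w = (w - z)⁻¹ * F w) :
    ∫ t : ℝ, G (t + a * Complex.I) = 0 := by
  have hline : ∀ y : ℝ, y ≠ z.im → ∀ t : ℝ, G (t + y * Complex.I) =
      ((t : ℂ) + y * Complex.I - z)⁻¹ • F (t + y * Complex.I) := by
    intro y hy t
    refine hGF _ fun h => hy ?_
    simpa using congrArg Complex.im h
  have hint : ∀ y : ℝ, a ≤ y → y ≠ z.im → Integrable fun t : ℝ => G (t + y * Complex.I) := by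
    intro y hay hy
    simp_rw [hline y hy]
    exact integrable_kernel_smul hp hp_top ⟨hFm y hay, (hF y hay).trans_lt hM.lt_top⟩
      (measurable_inv_sub z y).aestronglyMeasurable
      (norm_inv_sub_le (abs_pos.2 (sub_ne_zero.2 hy)) le_rfl)
  set q := ENNReal.conjExponent p
  have hq : 1 < q := one_lt_conjExponent hp hp_top
  have hq_top : q ≠ ∞ := conjExponent_ne_top hp
  set S := {t : ℝ | |z.re| + 1 ≤ |t|}
  have hS : MeasurableSet S := measurableSet_le measurable_const (by fun_prop)
  have hshift : ∀ b, a ≤ b → b ≠ z.im →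
      ∫ t : ℝ, G (t + a * Complex.I) = ∫ t : ℝ, G (t + b * Complex.I) := by
    intro b hab hb
    refine integral_line_eq (R₀ := |z.re| + 1) hab hG (hint a le_rfl hza.symm) (hint b hab hb) ?_
    have hdom := (memLp_inv_one_add_abs hq hq_top).const_mul (|z.re| + 2)
    calc _ ≤ ∫⁻ y in Set.Icc a b,
          eLpNorm (fun t : ℝ => (|z.re| + 2) * (1 + |t|)⁻¹) q volume * M := by
          refine setLIntegral_mono' measurableSet_Icc fun y hy => ?_
          have hkm := ((measurable_inv_sub z y).indicator hS).aestronglyMeasurable (μ := volume)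
          have h1 := lintegral_enorm_smul_le hp.le hkm (hFm y hy.1)
          calc _ ≤ ∫⁻ t, ‖S.indicator (fun t : ℝ => ((t : ℂ) + y * Complex.I - z)⁻¹) t •
                F (t + y * Complex.I)‖ₑ := by
                rw [← lintegral_indicator hS]
                refine lintegral_mono fun t => ?_
                by_cases ht : t ∈ S
                · rw [Set.indicator_of_mem ht, Set.indicator_of_mem ht, hGF, smul_eq_mul]
                  intro h
                  have h2 : t = z.re := by simpa using congrArg Complex.re h
                  have h3 : |z.re| + 1 ≤ |t| := ht
                  rw [h2] at h3
                  linarith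
                · simp [Set.indicator_of_notMem ht]
            _ ≤ _ := h1
            _ ≤ _ := by
                refine mul_le_mul' (eLpNorm_mono_real fun t => ?_) (hF y hy.1)
                by_cases ht : t ∈ S
                · rw [Set.indicator_of_mem ht]
                  exact norm_inv_sub_le_of_le_abs ht y
                · rw [Set.indicator_of_notMem ht, norm_zero]
                  positivity
      _ < ∞ := by
          rw [setLIntegral_const]
          exact ENNReal.mul_lt_top (ENNReal.mul_lt_top hdom.2 hM.lt_top) (by simp)
  have hzero := ENNReal.Tendsto.mul_const (b := M) (tendsto_eLpNorm_inv_sub hq hq_top z) (Or.inr hM)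
  rw [zero_mul] at hzero
  rw [← enorm_eq_zero, ← nonpos_iff_eq_zero]
  refine ge_of_tendsto hzero ?_
  filter_upwards [eventually_ge_atTop a, eventually_gt_atTop z.im] with b hb hbz
  rw [hshift b hb hbz.ne']
  refine (enorm_integral_le_lintegral_enorm _).trans ?_
  simp_rw [hline b hbz.ne']
  refine (lintegral_enorm_smul_le hp.le (measurable_inv_sub z b).aestronglyMeasurable
    (hFm b hb)).trans ?_
  gcongr
  exact hF b hb

/-- `F`, on the upper half-plane, is the Cauchy integral of `f`, and the Cauchy integral of `f`
vanishes on the lower half-plane. -/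
def IsCauchyRepr {E : Type*} [NormedAddCommGroup E] [NormedSpace ℂ E] (F : ℂ → E) (f : ℝ → E) :
    Prop :=
  ∀ z : ℂ, 0 < z.im →
    ∫ t : ℝ, ((t : ℂ) - z)⁻¹ • f t = (2 * Real.pi * Complex.I) • F z ∧
    ∫ t : ℝ, ((t : ℂ) - starRingEnd ℂ z)⁻¹ • f t = 0

lemma integral_inv_sub_sq_add_sq (x : ℝ) {y : ℝ} (hy : 0 < y) :
    ∫ t : ℝ, ((t - x) ^ 2 + y ^ 2)⁻¹ = Real.pi / y := by
  have h1 := integral_kernel_comp_affine (fun s => (1 + s ^ 2)⁻¹) (fun _ => (1 : ℝ)) x hy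
  simp only [smul_eq_mul, mul_one, integral_univ_inv_one_add_sq] at h1
  rw [h1, div_eq_inv_mul, ← integral_const_mul]
  refine integral_congr_ae (.of_forall fun t => ?_)
  have h : (t - x) ^ 2 + y ^ 2 ≠ 0 := by positivity
  have h' : 1 + ((t - x) / y) ^ 2 ≠ 0 := by positivity
  field_simp
  ring

section Line

variable {E : Type*} [NormedAddCommGroup E] [NormedSpace ℂ E] {p : ℝ≥0∞} {F : ℂ → E}

lemma MemHardy.continuous_line (hF : MemHardy p F) {y : ℝ} (hy : 0 < y) :
    Continuous fun t : ℝ => F (t + y * Complex.I) :=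
  hF.1.continuousOn.comp_continuous (by fun_prop) fun t => by simpa using hy

omit [NormedSpace ℂ E] in
lemma eLpNorm_line_le_iSup (p : ℝ≥0∞) (F : ℂ → E) {y : ℝ} (hy : 0 < y) :
    eLpNorm (fun t : ℝ => F (t + y * Complex.I)) p volume ≤
      ⨆ (y : ℝ) (_ : 0 < y), eLpNorm (fun x : ℝ => F (x + y * Complex.I)) p volume :=
  le_iSup₂ (f := fun (y : ℝ) (_ : 0 < y) =>
    eLpNorm (fun x : ℝ => F (x + y * Complex.I)) p volume) y hy

lemma MemHardy.memLp_line (hF : MemHardy p F) {y : ℝ} (hy : 0 < y) :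
    MemLp (fun t : ℝ => F (t + y * Complex.I)) p volume :=
  ⟨(hF.continuous_line hy).aestronglyMeasurable, (eLpNorm_line_le_iSup p F hy).trans_lt hF.2⟩

end Line

lemma sub_ne_zero_of_im_ne {z : ℂ} (hz : z.im ≠ 0) (t : ℝ) : (t : ℂ) - z ≠ 0 := fun h =>
  hz (by simpa using congrArg Complex.im h)

lemma ofReal_inv_sq_add_sq (z : ℂ) (t : ℝ) :
    ((((t - z.re) ^ 2 + z.im ^ 2)⁻¹ : ℝ) : ℂ) =
      ((t : ℂ) - z)⁻¹ * ((t : ℂ) - starRingEnd ℂ z)⁻¹ := by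
  rw [← mul_inv]
  push_cast
  congr 1
  apply Complex.ext <;> simp [pow_two]
  ring

/-- Cauchy's formula on the line `Im w = a`. Inside the half-plane the pole at `z` is compensated
by subtracting from `F` a multiple of `1 / (w - ζ)`, with `ζ` the mirror image of `z` in the line;
this leaves the explicit integral of `1 / |t - z|²`. -/
lemma MemHardy.isCauchyRepr_line {p : ℝ≥0∞} (hp : 1 < p) (hp_top : p ≠ ∞) {F : ℂ → ℂ}
    (hF : MemHardy p F) {a : ℝ} (ha : 0 < a) :
    IsCauchyRepr (fun z => F (z + a * Complex.I)) (fun t : ℝ => F (t + a * Complex.I)) := by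
  intro z hz
  have hsub : {w : ℂ | a ≤ w.im} ⊆ {w : ℂ | 0 < w.im} := fun w hw => ha.trans_le hw
  set ζ : ℂ := starRingEnd ℂ z + a * Complex.I
  have hζ : ∀ w : ℂ, a ≤ w.im → w - ζ ≠ 0 := fun w hw h => by
    have h1 : w.im - ζ.im = 0 := by simpa using congrArg Complex.im h
    have h2 : ζ.im = -z.im + a := by simp [ζ]
    linarith
  have htζ : ∀ t : ℝ, (t : ℂ) + a * Complex.I - ζ = t - starRingEnd ℂ z := fun t => by
    simp only [ζ]; ring
  set M := ⨆ (y : ℝ) (_ : 0 < y), eLpNorm (fun x : ℝ => F (x + y * Complex.I)) p volume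
  have hM : M ≠ ∞ := hF.2.ne
  constructor
  · set z' : ℂ := z + a * Complex.I
    have hz' : a < z'.im := by simpa [z'] using hz
    have htz : ∀ t : ℝ, (t : ℂ) + a * Complex.I - z' = t - z := fun t => by
      simp only [z']; ring
    set c : ℂ := F z' * (z' - ζ)
    let F₁ : ℂ → ℂ := fun w => F w - c * (w - ζ)⁻¹
    have hF₁z : F₁ z' = 0 := by
      simp only [F₁, c]
      rw [mul_inv_cancel_right₀ (hζ z' hz'.le), sub_self]
    have hF₁d : DifferentiableOn ℂ F₁ {w | a ≤ w.im} := by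
      refine (hF.1.mono hsub).sub (DifferentiableOn.const_mul ?_ _)
      exact DifferentiableOn.inv (by fun_prop) hζ
    have hnhds : {w : ℂ | a ≤ w.im} ∈ 𝓝 z' :=
      Filter.mem_of_superset ((isOpen_lt continuous_const Complex.continuous_im).mem_nhds hz')
        fun w (hw : a < w.im) => (hw.le : a ≤ w.im)
    set B : ℝ≥0∞ := eLpNorm (fun t : ℝ => ((1 + |ζ.re|) / z.im + 1) * (1 + |t|)⁻¹) p volume
    have hB : B < ∞ := ((memLp_inv_one_add_abs hp hp_top).const_mul _).2
    have hmeas : ∀ y : ℝ, AEStronglyMeasurable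
        (fun t : ℝ => c * ((t : ℂ) + y * Complex.I - ζ)⁻¹) volume := fun y =>
      ((measurable_inv_sub ζ y).const_mul c).aestronglyMeasurable
    have h0 := integral_line_eq_zero hp hp_top (F := F₁) (G := dslope F₁ z') (a := a)
      (M := M + ‖c‖ₑ * B) (ENNReal.add_ne_top.2 ⟨hM, ENNReal.mul_ne_top enorm_ne_top hB.ne⟩)
      (z := z') hz'.ne'
      (fun y hy => (hF.continuous_line (ha.trans_le hy)).aestronglyMeasurable.sub (hmeas y))
      (fun y hy => by
        refine (eLpNorm_sub_le (hF.continuous_line (ha.trans_le hy)).aestronglyMeasurable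
          (hmeas y) hp.le).trans (add_le_add (eLpNorm_line_le_iSup p F (ha.trans_le hy)) ?_)
        have h1 := eLpNorm_const_smul (p := p) (μ := volume) c
          (fun t : ℝ => ((t : ℂ) + y * Complex.I - ζ)⁻¹)
        refine (h1.le).trans (mul_le_mul_right (eLpNorm_mono_real fun t => ?_) _)
        refine norm_inv_sub_le hz ?_ t
        have h2 : ζ.im = -z.im + a := by simp [ζ]
        rw [h2]
        exact le_trans (by linarith) (le_abs_self _))
      ((Complex.differentiableOn_dslope hnhds).2 hF₁d)
      (fun w hw => by
        rw [dslope_of_ne _ hw, slope_def_module, hF₁z, sub_zero, smul_eq_mul])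
    have hline : ∀ t : ℝ, dslope F₁ z' (t + a * Complex.I) =
        ((t : ℂ) - z)⁻¹ • F (t + a * Complex.I) -
          c * ((((t - z.re) ^ 2 + z.im ^ 2)⁻¹ : ℝ) : ℂ) := by
      intro t
      have hne : (t : ℂ) + a * Complex.I ≠ z' := fun h => by
        have := congrArg Complex.im h
        simp only [Complex.add_im, Complex.ofReal_im, Complex.mul_im, Complex.ofReal_re,
          Complex.I_im, Complex.I_re] at this
        linarith
      rw [dslope_of_ne _ hne, slope_def_module, hF₁z, sub_zero, smul_eq_mul, smul_eq_mul, htz,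
        ofReal_inv_sq_add_sq]
      simp only [F₁]
      rw [htζ]
      ring
    simp_rw [hline] at h0
    have hi1 : Integrable fun t : ℝ => ((t : ℂ) - z)⁻¹ • F (t + a * Complex.I) := by
      refine integrable_kernel_smul (C := (1 + |z.re|) / z.im + 1) hp hp_top (hF.memLp_line ha)
        (by fun_prop : Measurable fun t : ℝ => ((t : ℂ) - z)⁻¹).aestronglyMeasurable fun t => ?_
      have := norm_inv_sub_le (z := z) (y := 0) hz (by
        rw [zero_sub, abs_neg]; exact le_abs_self _) t
      simpa using this
    have hi2 : Integrable fun t : ℝ => ((t - z.re) ^ 2 + z.im ^ 2)⁻¹ := by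
      by_contra hni
      have h1 := integral_undef hni
      rw [integral_inv_sub_sq_add_sq z.re hz] at h1
      exact (div_pos Real.pi_pos hz).ne' h1
    have hi3 : Integrable fun t : ℝ => c * ((((t - z.re) ^ 2 + z.im ^ 2)⁻¹ : ℝ) : ℂ) :=
      hi2.ofReal.const_mul c
    rw [integral_sub hi1 hi3, integral_const_mul, integral_complex_ofReal,
      integral_inv_sub_sq_add_sq z.re hz, sub_eq_zero] at h0
    rw [h0]
    change _ = (2 * Real.pi * Complex.I) • F z'
    have hc : z' - ζ = 2 * z.im * Complex.I := by
      simp only [z', ζ]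
      apply Complex.ext <;> simp
      ring
    have hz0 : (z.im : ℂ) ≠ 0 := by exact_mod_cast hz.ne'
    simp only [c, hc, smul_eq_mul]
    push_cast
    field_simp
  · have h0 := integral_line_eq_zero hp hp_top (F := F) (G := fun w => (w - ζ)⁻¹ * F w) (a := a)
      hM (z := ζ) (by simpa [ζ] using hz.ne')
      (fun y hy => (hF.continuous_line (ha.trans_le hy)).aestronglyMeasurable)
      (fun y hy => eLpNorm_line_le_iSup p F (ha.trans_le hy))
      (DifferentiableOn.mul (DifferentiableOn.inv (by fun_prop) hζ) (hF.1.mono hsub))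
      (fun w _ => rfl)
    simp_rw [htζ] at h0
    simpa only [smul_eq_mul] using h0

/-! ### Poisson and conjugate Poisson integrals of boundary functions -/

section Repr

variable {E : Type*} [NormedAddCommGroup E] [NormedSpace ℂ E] {p : ℝ≥0∞} {F : ℂ → E} {f : ℝ → E}

lemma measurable_inv_ofReal_sub (z : ℂ) : Measurable fun t : ℝ => ((t : ℂ) - z)⁻¹ := by fun_prop

lemma norm_inv_ofReal_sub_le {z : ℂ} (hz : z.im ≠ 0) (t : ℝ) :
    ‖((t : ℂ) - z)⁻¹‖ ≤ ((1 + |z.re|) / |z.im| + 1) * (1 + |t|)⁻¹ := by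
  have := norm_inv_sub_le (z := z) (y := 0) (abs_pos.2 hz) (by rw [zero_sub, abs_neg]) t
  simpa using this

lemma integrable_cauchyKernel_smul (hp : 1 < p) (hp_top : p ≠ ∞) (hf : MemLp f p volume) {z : ℂ}
    (hz : z.im ≠ 0) : Integrable fun t : ℝ => ((t : ℂ) - z)⁻¹ • f t :=
  integrable_kernel_smul hp hp_top hf (measurable_inv_ofReal_sub z).aestronglyMeasurable
    (norm_inv_ofReal_sub_le hz)

/-- The difference of the Cauchy integrals at conjugate points is the Poisson integral. -/
lemma IsCauchyRepr.integral_poisson (hp : 1 < p) (hp_top : p ≠ ∞) (hf : MemLp f p volume)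
    (h : IsCauchyRepr F f) {z : ℂ} (hz : 0 < z.im) :
    ∫ t : ℝ, (z.im * ((t - z.re) ^ 2 + z.im ^ 2)⁻¹) • f t = Real.pi • F z := by
  have hz' : (starRingEnd ℂ z).im ≠ 0 := by simpa using hz.ne'
  have h1 := integral_sub (integrable_cauchyKernel_smul hp hp_top hf hz.ne')
    (integrable_cauchyKernel_smul hp hp_top hf hz')
  rw [(h z hz).1, (h z hz).2, sub_zero] at h1
  have h2 : ∀ t : ℝ, (z.im * ((t - z.re) ^ 2 + z.im ^ 2)⁻¹) • f t = (2 * Complex.I)⁻¹ •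
      (((t : ℂ) - z)⁻¹ • f t - ((t : ℂ) - starRingEnd ℂ z)⁻¹ • f t) := fun t => by
    rw [← sub_smul, smul_smul, ← Complex.coe_smul]
    congr 1
    rw [Complex.ofReal_mul, ofReal_inv_sq_add_sq]
    have e1 := sub_ne_zero_of_im_ne hz.ne' t
    have e2 := sub_ne_zero_of_im_ne hz' t
    field_simp
    apply Complex.ext <;> simp
    ring
  simp_rw [h2]
  rw [integral_smul, h1, smul_smul, ← Complex.coe_smul]
  congr 1
  field_simp

/-- The mean of the Cauchy integrals at conjugate points is the conjugate Poisson integral. -/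
lemma IsCauchyRepr.integral_conjPoisson (hp : 1 < p) (hp_top : p ≠ ∞) (hf : MemLp f p volume)
    (h : IsCauchyRepr F f) {z : ℂ} (hz : 0 < z.im) :
    ∫ t : ℝ, ((t - z.re) * ((t - z.re) ^ 2 + z.im ^ 2)⁻¹) • f t =
      (Real.pi * Complex.I) • F z := by
  have hz' : (starRingEnd ℂ z).im ≠ 0 := by simpa using hz.ne'
  have h1 := integral_add (integrable_cauchyKernel_smul hp hp_top hf hz.ne')
    (integrable_cauchyKernel_smul hp hp_top hf hz')
  rw [(h z hz).1, (h z hz).2, add_zero] at h1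
  have h2 : ∀ t : ℝ, ((t - z.re) * ((t - z.re) ^ 2 + z.im ^ 2)⁻¹) • f t = (2 : ℂ)⁻¹ •
      (((t : ℂ) - z)⁻¹ • f t + ((t : ℂ) - starRingEnd ℂ z)⁻¹ • f t) := fun t => by
    rw [← add_smul, smul_smul, ← Complex.coe_smul]
    congr 1
    rw [Complex.ofReal_mul, ofReal_inv_sq_add_sq]
    have e1 := sub_ne_zero_of_im_ne hz.ne' t
    have e2 := sub_ne_zero_of_im_ne hz' t
    field_simp
    apply Complex.ext <;> simp
    ring
  simp_rw [h2]
  rw [integral_smul, h1, smul_smul]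
  congr 1
  ring

/-- The Poisson integral, centred at `x` and observed at horizontal distance `b y` from it. -/
lemma IsCauchyRepr.integral_poisson_dilate (hp : 1 < p) (hp_top : p ≠ ∞) (hf : MemLp f p volume)
    (h : IsCauchyRepr F f) (x b : ℝ) {y : ℝ} (hy : 0 < y) :
    ∫ s : ℝ, (1 + (s - b) ^ 2)⁻¹ • f (x + y * s) =
      Real.pi • F ((x + b * y : ℝ) + y * Complex.I) := by
  have h1 := h.integral_poisson hp hp_top hf (z := (x + b * y : ℝ) + y * Complex.I)
    (by simpa using hy)
  rw [← h1, integral_kernel_comp_affine (fun s => (1 + (s - b) ^ 2)⁻¹) f x hy]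
  refine integral_congr_ae (.of_forall fun t => ?_)
  simp only [Complex.add_im, Complex.ofReal_im, Complex.mul_im, Complex.ofReal_re, Complex.I_im,
    Complex.I_re, Complex.add_re, Complex.mul_re]
  congr 1
  have e1 : 1 + ((t - x) / y - b) ^ 2 ≠ 0 := by positivity
  have e2 : (t - (x + b * y)) ^ 2 + y ^ 2 ≠ 0 := by positivity
  have e3 : (t - (x + b * y)) ^ 2 + y ^ 2 = y ^ 2 * (1 + ((t - x) / y - b) ^ 2) := by
    field_simp
    ring
  have e4 : (t - (x + b * y + (y * 0 - 0 * 1))) ^ 2 + (0 + (y * 1 + 0 * 0)) ^ 2 =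
    (t - (x + b * y)) ^ 2 + y ^ 2 := by ring
  rw [e4, e3]
  field_simp
  ring

lemma IsCauchyRepr.integral_conjPoisson_dilate (hp : 1 < p) (hp_top : p ≠ ∞)
    (hf : MemLp f p volume) (h : IsCauchyRepr F f) (x : ℝ) {y : ℝ} (hy : 0 < y) :
    ∫ s : ℝ, (s * (1 + s ^ 2)⁻¹) • f (x + y * s) =
      (Real.pi * Complex.I) • F (x + y * Complex.I) := by
  have h1 := h.integral_conjPoisson hp hp_top hf (z := x + y * Complex.I) (by simpa using hy)
  rw [← h1, integral_kernel_comp_affine (fun s => s * (1 + s ^ 2)⁻¹) f x hy]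
  refine integral_congr_ae (.of_forall fun t => ?_)
  simp only [Complex.add_im, Complex.ofReal_im, Complex.mul_im, Complex.ofReal_re, Complex.I_im,
    Complex.I_re, Complex.add_re, Complex.mul_re]
  congr 1
  have e1 : 1 + ((t - x) / y) ^ 2 ≠ 0 := by positivity
  have e3 : (t - (x + (y * 0 - 0 * 1))) ^ 2 + (0 + (y * 1 + 0 * 0)) ^ 2 =
      y ^ 2 * (1 + ((t - x) / y) ^ 2) := by
    field_simp
    ring
  rw [e3]
  field_simp
  ring

end Repr

/-! ### Contraction and approximation by Poisson integrals -/

section PoissonIntegral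

variable {E : Type*} [NormedAddCommGroup E] [NormedSpace ℂ E] {p : ℝ≥0∞} {F : ℂ → E} {f : ℝ → E}

/-- The Poisson integral of `f` does not increase the `L^p` norm. -/
lemma IsCauchyRepr.eLpNorm_line_le (hp : 1 < p) (hp_top : p ≠ ∞) (hf : MemLp f p volume)
    (hfm : StronglyMeasurable f) (h : IsCauchyRepr F f) {y : ℝ} (hy : 0 < y) :
    eLpNorm (fun x : ℝ => F (x + y * Complex.I)) p volume ≤ eLpNorm f p volume := by
  set κ := ProbabilityTheory.cauchyMeasure 0 1
  have hp0 : p ≠ 0 := (zero_lt_one.trans hp).ne'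
  have hr : 1 ≤ p.toReal := by
    simpa using ENNReal.toReal_mono hp_top hp.le
  have hm : Measurable fun q : ℝ × ℝ => ‖f (q.1 + y * q.2)‖ₑ :=
    (hfm.comp_measurable (by fun_prop)).enorm
  have hpt : ∀ x : ℝ, ‖F (x + y * Complex.I)‖ₑ ≤ ∫⁻ s, ‖f (x + y * s)‖ₑ ∂κ := by
    intro x
    have h1 := h.integral_poisson_dilate hp hp_top hf x 0 hy
    simp only [sub_zero, zero_mul, add_zero] at h1
    have h2 : F (x + y * Complex.I) = ∫ s : ℝ, (Real.pi⁻¹ * (1 + s ^ 2)⁻¹) • f (x + y * s) := by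
      simp_rw [mul_smul]
      rw [integral_smul, h1, smul_smul, inv_mul_cancel₀ Real.pi_pos.ne', one_smul]
    rw [h2, lintegral_cauchyMeasure (fun s => ‖f (x + y * s)‖ₑ) (hm.comp measurable_prodMk_left)]
    refine (enorm_integral_le_lintegral_enorm _).trans_eq (lintegral_congr fun s => ?_)
    rw [enorm_smul, Real.enorm_of_nonneg (by positivity)]
  rw [eLpNorm_eq_lintegral_rpow_enorm_toReal hp0 hp_top,
    eLpNorm_eq_lintegral_rpow_enorm_toReal hp0 hp_top]
  refine ENNReal.rpow_le_rpow ?_ (by positivity)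
  calc ∫⁻ x : ℝ, ‖F (x + y * Complex.I)‖ₑ ^ p.toReal
      ≤ ∫⁻ x, ∫⁻ s, ‖f (x + y * s)‖ₑ ^ p.toReal ∂κ := by
        refine lintegral_mono fun x => ?_
        exact (ENNReal.rpow_le_rpow (hpt x) (by positivity)).trans
          (rpow_lintegral_le_of_isProbabilityMeasure κ hr
            (hm.comp measurable_prodMk_left).aemeasurable)
    _ = ∫⁻ _, (∫⁻ x, ‖f x‖ₑ ^ p.toReal) ∂κ := by
        rw [lintegral_lintegral_swap (hm.pow_const _).aemeasurable]
        refine lintegral_congr fun s => ?_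
        exact lintegral_add_right_eq_self (fun x => ‖f x‖ₑ ^ p.toReal) (y * s)
    _ = _ := by rw [lintegral_const, measure_univ, mul_one]

variable [CompleteSpace E]

lemma inv_one_add_sub_sq_le {a b : ℝ} (hb : |b| ≤ a) (s : ℝ) :
    (1 + (s - b) ^ 2)⁻¹ ≤ (2 + 2 * a ^ 2) * (1 + s ^ 2)⁻¹ := by
  rw [← div_eq_mul_inv, le_div_iff₀ (by positivity), inv_mul_le_iff₀ (by positivity)]
  have h : b ^ 2 ≤ a ^ 2 := by
    rw [← sq_abs b]
    gcongr
  nlinarith [sq_nonneg (s - 2 * b), mul_nonneg (sq_nonneg a) (sq_nonneg (s - b))]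

/-- Within a cone of aperture `a` over `x`, the Poisson integral of `f` differs from `f x` by at
most a multiple of the Poisson oscillation. -/
lemma IsCauchyRepr.enorm_sub_le (hp : 1 < p) (hp_top : p ≠ ∞) (hf : MemLp f p volume)
    (hfm : StronglyMeasurable f) (h : IsCauchyRepr F f) (x : ℝ) {a b : ℝ} (hb : |b| ≤ a) {y : ℝ}
    (hy : 0 < y) :
    ‖F ((x + b * y : ℝ) + y * Complex.I) - f x‖ₑ ≤
      ENNReal.ofReal (2 + 2 * a ^ 2) * poissonOsc f y x := by
  have h1 := enorm_integral_dilate_sub_le hp hp_top hf hfm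
    (k := fun s => Real.pi⁻¹ * (1 + (s - b) ^ 2)⁻¹) (C := Real.pi⁻¹ * (2 + 2 * a ^ 2))
    (by fun_prop) (fun s => by
      rw [abs_of_nonneg (by positivity), mul_assoc]
      exact mul_le_mul_of_nonneg_left (inv_one_add_sub_sq_le hb s) (by positivity)) x hy.ne'
  have h2 : ∫ s : ℝ, (1 + (s - b) ^ 2)⁻¹ = Real.pi := by
    rw [integral_sub_right_eq_self (fun s : ℝ => (1 + s ^ 2)⁻¹) b, integral_univ_inv_one_add_sq]
  simp_rw [mul_smul] at h1
  rw [integral_smul, h.integral_poisson_dilate hp hp_top hf x b hy, integral_const_mul, h2,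
    smul_smul, inv_mul_cancel₀ Real.pi_pos.ne', one_smul, one_smul, ← mul_assoc,
    mul_inv_cancel₀ Real.pi_pos.ne', one_mul] at h1
  exact h1

omit [NormedSpace ℂ E] [CompleteSpace E] in
lemma tendsto_eLpNorm_of_enorm_le_poissonOsc (hp : 1 ≤ p) (hp_top : p ≠ ∞) (hf : MemLp f p volume)
    (hfm : StronglyMeasurable f) {C : ℝ≥0∞} (hC : C ≠ ∞) {g : ℝ → ℝ → E}
    (hg : ∀ y, 0 < y → ∀ x, ‖g y x‖ₑ ≤ C * poissonOsc f y x) :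
    Tendsto (fun y => eLpNorm (g y) p volume) (𝓝[>] 0) (𝓝 0) := by
  have h1 := ENNReal.Tendsto.const_mul (a := C) (tendsto_eLpNorm_poissonOsc hp hp_top hf hfm)
    (Or.inr hC)
  rw [mul_zero] at h1
  refine tendsto_of_tendsto_of_tendsto_of_le_of_le' tendsto_const_nhds h1
    (.of_forall fun _ => zero_le) ?_
  filter_upwards [self_mem_nhdsWithin] with y hy
  lift C to NNReal using hC
  exact eLpNorm_le_nnreal_smul_eLpNorm_of_ae_le_mul' (.of_forall (hg y hy)) p

lemma IsCauchyRepr.tendsto_eLpNorm_sub (hp : 1 < p) (hp_top : p ≠ ∞) (hf : MemLp f p volume)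
    (hfm : StronglyMeasurable f) (h : IsCauchyRepr F f) :
    Tendsto (fun y : ℝ => eLpNorm (fun x : ℝ => F (x + y * Complex.I) - f x) p volume)
      (𝓝[>] 0) (𝓝 0) := by
  refine tendsto_eLpNorm_of_enorm_le_poissonOsc (C := ENNReal.ofReal (2 + 2 * 0 ^ 2)) hp.le hp_top
    hf hfm ENNReal.ofReal_ne_top fun y hy x => ?_
  simpa using h.enorm_sub_le hp hp_top hf hfm x (a := 0) (b := 0) (by simp) hy

/-- A function represented by an `L^p` function has it as its boundary value. -/
lemma IsCauchyRepr.isBoundaryValue (hp : 1 < p) (hp_top : p ≠ ∞) (hf : MemLp f p volume)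
    (hfm : StronglyMeasurable f) (h : IsCauchyRepr F f) : IsBoundaryValue p F f := by
  refine ⟨hf, ?_, h.tendsto_eLpNorm_sub hp hp_top hf hfm⟩
  filter_upwards [ae_tendsto_poissonOsc hp.le hp_top hf hfm] with x hx a ha
  rw [tendsto_iff_edist_tendsto_0]
  have him : Tendsto Complex.im (𝓝[stolzCone x a] (x : ℂ)) (𝓝[>] 0) := by
    refine tendsto_nhdsWithin_iff.2 ⟨?_, ?_⟩
    · have := (Complex.continuous_im.tendsto (x : ℂ)).mono_left
        (nhdsWithin_le_nhds (s := stolzCone x a))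
      simpa using this
    · filter_upwards [self_mem_nhdsWithin] with z hz using hz.1
  have h1 := ENNReal.Tendsto.const_mul (a := ENNReal.ofReal (2 + 2 * a ^ 2)) (hx.comp him)
    (Or.inr ENNReal.ofReal_ne_top)
  rw [mul_zero] at h1
  refine tendsto_of_tendsto_of_tendsto_of_le_of_le' tendsto_const_nhds h1
    (.of_forall fun _ => zero_le) ?_
  filter_upwards [self_mem_nhdsWithin] with z hz
  have hz0 : 0 < z.im := hz.1
  have h2 := h.enorm_sub_le hp hp_top hf hfm x (a := a) (b := (z.re - x) / z.im)
    (by rw [abs_div, abs_of_pos hz0, div_le_iff₀ hz0]; exact hz.2.le) hz0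
  rwa [div_mul_cancel₀ _ hz0.ne', add_sub_cancel, Complex.re_add_im, ← edist_eq_enorm_sub] at h2

end PoissonIntegral

/-! ### Existence of boundary functions -/

/-- Quantitative strict convexity of `‖·‖ ^ r` on `ℂ`, obtained from compactness of the set
`‖a‖ ^ r + ‖b‖ ^ r = 1` and homogeneity. -/
lemma exists_norm_sub_rpow_le {r η : ℝ} (hr : 1 < r) (hη : 0 < η) :
    ∃ C : ℝ, 0 ≤ C ∧ ∀ a b : ℂ, ‖a - b‖ ^ r ≤ η * (‖a‖ ^ r + ‖b‖ ^ r) +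
      C * ((‖a‖ ^ r + ‖b‖ ^ r) / 2 - ‖(1 / 2 : ℝ) • (a + b)‖ ^ r) := by
  have hr0 : 0 < r := zero_lt_one.trans hr
  have hmid : ∀ a b : ℂ, ‖(1 / 2 : ℝ) • (a + b)‖ ≤ (1 / 2 : ℝ) * ‖a‖ + (1 / 2 : ℝ) * ‖b‖ := by
    intro a b
    rw [norm_smul, ← mul_add]
    simpa using norm_add_le a b
  let δ : ℂ × ℂ → ℝ := fun q =>
    (‖q.1‖ ^ r + ‖q.2‖ ^ r) / 2 - ‖(1 / 2 : ℝ) • (q.1 + q.2)‖ ^ r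
  have hδ0 : ∀ q, 0 ≤ δ q := by
    intro q
    have h1 := (convexOn_rpow hr.le).2 (norm_nonneg q.1) (norm_nonneg q.2)
      (by norm_num : (0 : ℝ) ≤ 1 / 2) (by norm_num : (0 : ℝ) ≤ 1 / 2) (by norm_num)
    have h2 := Real.rpow_le_rpow (norm_nonneg _) (hmid q.1 q.2) hr0.le
    simp only [smul_eq_mul] at h1
    simp only [δ]
    linarith
  have hδpos : ∀ q : ℂ × ℂ, q.1 ≠ q.2 → 0 < δ q := by
    intro q hq
    by_cases hn : ‖q.1‖ = ‖q.2‖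
    · have h1 := (norm_midpoint_lt_iff hn).2 hq
      have h2 := Real.rpow_lt_rpow (norm_nonneg _) h1 hr0
      simp only [δ]
      rw [← hn]
      linarith
    · have h1 := (strictConvexOn_rpow hr).2 (norm_nonneg q.1) (norm_nonneg q.2) hn
        (by norm_num : (0 : ℝ) < 1 / 2) (by norm_num : (0 : ℝ) < 1 / 2) (by norm_num)
      have h2 := Real.rpow_le_rpow (norm_nonneg _) (hmid q.1 q.2) hr0.le
      simp only [smul_eq_mul] at h1
      simp only [δ]
      linarith
  have hc1 : Continuous fun q : ℂ × ℂ => ‖q.1‖ ^ r + ‖q.2‖ ^ r :=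
    (continuous_fst.norm.rpow_const fun _ => Or.inr hr0.le).add
      (continuous_snd.norm.rpow_const fun _ => Or.inr hr0.le)
  have hδc : Continuous δ :=
    (hc1.div_const 2).sub ((by fun_prop : Continuous fun q : ℂ × ℂ =>
      ‖(1 / 2 : ℝ) • (q.1 + q.2)‖).rpow_const fun _ => Or.inr hr0.le)
  have hc2 : Continuous fun q : ℂ × ℂ => ‖q.1 - q.2‖ ^ r :=
    (continuous_fst.sub continuous_snd).norm.rpow_const fun _ => Or.inr hr0.le
  have hle : ∀ q : ℂ × ℂ, ‖q.1‖ ^ r + ‖q.2‖ ^ r = 1 → ‖q.1‖ ≤ 1 ∧ ‖q.2‖ ≤ 1 := by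
    intro q hq
    have h1 : 0 ≤ ‖q.1‖ ^ r := by positivity
    have h2 : 0 ≤ ‖q.2‖ ^ r := by positivity
    constructor
    · by_contra hlt
      have := Real.one_lt_rpow (not_le.1 hlt) hr0
      linarith
    · by_contra hlt
      have := Real.one_lt_rpow (not_le.1 hlt) hr0
      linarith
  set S : Set (ℂ × ℂ) := {q | ‖q.1‖ ^ r + ‖q.2‖ ^ r = 1} ∩ {q | η ≤ ‖q.1 - q.2‖ ^ r}
  have hS : IsCompact S := by
    refine Metric.isCompact_of_isClosed_isBounded
      ((isClosed_eq hc1 continuous_const).inter (isClosed_le continuous_const hc2)) ?_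
    refine Metric.isBounded_closedBall (x := (0 : ℂ × ℂ)) (r := 1) |>.subset fun q hq => ?_
    rw [mem_closedBall_zero_iff, Prod.norm_def]
    exact max_le (hle q hq.1).1 (hle q hq.1).2
  obtain ⟨m, hm, hmS⟩ : ∃ m : ℝ, 0 < m ∧ ∀ q ∈ S, m ≤ δ q := by
    rcases S.eq_empty_or_nonempty with he | hne
    · exact ⟨1, one_pos, by simp [he]⟩
    · obtain ⟨q, hq, hmin⟩ := hS.exists_isMinOn hne hδc.continuousOn
      refine ⟨δ q, hδpos q fun h => ?_, fun q' hq' => hmin hq'⟩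
      have h1 : η ≤ ‖q.1 - q.2‖ ^ r := hq.2
      rw [h, sub_self, norm_zero, Real.zero_rpow hr0.ne'] at h1
      linarith
  -- On the unit set, `‖a - b‖ ^ r` is at most `2 ^ r`, and the convexity defect is at least `m`
  -- where `‖a - b‖ ^ r` exceeds `η`.
  refine ⟨2 ^ r / m, by positivity, ?_⟩
  have hunit : ∀ q : ℂ × ℂ, ‖q.1‖ ^ r + ‖q.2‖ ^ r = 1 →
      ‖q.1 - q.2‖ ^ r ≤ η + 2 ^ r / m * δ q := by
    intro q hq
    by_cases hη' : η ≤ ‖q.1 - q.2‖ ^ r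
    · have h1 := hmS q ⟨hq, hη'⟩
      have h2 : ‖q.1 - q.2‖ ^ r ≤ 2 ^ r := by
        refine Real.rpow_le_rpow (norm_nonneg _) ?_ hr0.le
        have := hle q hq
        linarith [norm_sub_le q.1 q.2]
      have h3 : 2 ^ r ≤ 2 ^ r / m * δ q := by
        rw [div_mul_eq_mul_div, le_div_iff₀ hm]
        gcongr
      linarith
    · have : 0 ≤ 2 ^ r / m * δ q := mul_nonneg (by positivity) (hδ0 q)
      linarith
  intro a b
  set N : ℝ := ‖a‖ ^ r + ‖b‖ ^ r
  rcases (by positivity : 0 ≤ N).eq_or_lt with h0 | hN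
  · have h1 : 0 ≤ ‖a‖ ^ r := by positivity
    have h2 : 0 ≤ ‖b‖ ^ r := by positivity
    have ha : a = 0 := by
      have : ‖a‖ ^ r = 0 := by simp only [N] at h0; linarith
      exact norm_eq_zero.1 ((Real.rpow_eq_zero (norm_nonneg _) hr0.ne').1 this)
    have hb : b = 0 := by
      have : ‖b‖ ^ r = 0 := by simp only [N] at h0; linarith
      exact norm_eq_zero.1 ((Real.rpow_eq_zero (norm_nonneg _) hr0.ne').1 this)
    rw [← h0, ha, hb]
    simp [Real.zero_rpow hr0.ne']
  · set l : ℝ := N ^ (-r⁻¹)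
    have hl : 0 < l := Real.rpow_pos_of_pos hN _
    have hlr : l ^ r = N⁻¹ := by
      rw [← Real.rpow_mul hN.le, neg_mul, inv_mul_cancel₀ hr0.ne', Real.rpow_neg_one]
    have hsc : ∀ v : ℂ, ‖l • v‖ ^ r = N⁻¹ * ‖v‖ ^ r := fun v => by
      rw [norm_smul, Real.norm_of_nonneg hl.le, Real.mul_rpow hl.le (norm_nonneg _), hlr]
    have h1 := hunit (l • a, l • b) (by
      simp only [hsc]
      rw [← mul_add]
      exact inv_mul_cancel₀ hN.ne')
    simp only [δ] at h1
    rw [← smul_sub, ← smul_add, smul_comm (1 / 2 : ℝ) l, hsc, hsc, hsc, hsc] at h1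
    have h2 := mul_le_mul_of_nonneg_left h1 hN.le
    rw [mul_inv_cancel_left₀ hN.ne'] at h2
    refine h2.trans (le_of_eq ?_)
    rw [← mul_add]
    simp only [N] at hN ⊢
    field_simp

lemma Lp.norm_rpow_eq_integral {p : ℝ≥0∞} (hp : 1 < p) (hp_top : p ≠ ∞) {g : ℝ → ℂ}
    (hg : MemLp g p volume) : ‖hg.toLp g‖ ^ p.toReal = ∫ t, ‖g t‖ ^ p.toReal := by
  have hp0 : p ≠ 0 := (zero_lt_one.trans hp).ne'
  have hr : 0 < p.toReal := ENNReal.toReal_pos hp0 hp_top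
  rw [Lp.norm_toLp, hg.eLpNorm_eq_integral_rpow_norm hp0 hp_top,
    ENNReal.toReal_ofReal (by positivity), ← Real.rpow_mul (by positivity),
    inv_mul_cancel₀ hr.ne', Real.rpow_one]

/-- Quantitative uniform convexity of `L^p`, integrated from the pointwise inequality. -/
lemma exists_norm_sub_rpow_le_Lp {p : ℝ≥0∞} (hp : 1 < p) (hp_top : p ≠ ∞) {η : ℝ} (hη : 0 < η) :
    ∃ C : ℝ, 0 ≤ C ∧ ∀ g h : Lp ℂ p (volume : Measure ℝ),
      ‖g - h‖ ^ p.toReal ≤ η * (‖g‖ ^ p.toReal + ‖h‖ ^ p.toReal) +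
      C * ((‖g‖ ^ p.toReal + ‖h‖ ^ p.toReal) / 2 - ‖(1 / 2 : ℝ) • (g + h)‖ ^ p.toReal) := by
  have hp0 : p ≠ 0 := (zero_lt_one.trans hp).ne'
  have hr : 1 < p.toReal := by
    simpa using (ENNReal.toReal_lt_toReal ENNReal.one_ne_top hp_top).2 hp
  obtain ⟨C, hC, h⟩ := exists_norm_sub_rpow_le hr hη
  refine ⟨C, hC, fun g g' => ?_⟩
  have hg := Lp.memLp g
  have hg' := Lp.memLp g'
  have e1 := Lp.norm_rpow_eq_integral hp hp_top hg
  have e2 := Lp.norm_rpow_eq_integral hp hp_top hg'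
  have e3 := Lp.norm_rpow_eq_integral hp hp_top (hg.sub hg')
  have hs := (hg.add hg').const_smul (1 / 2 : ℝ)
  have e4 := Lp.norm_rpow_eq_integral hp hp_top hs
  rw [MemLp.toLp_sub hg hg'] at e3
  rw [MemLp.toLp_const_smul (1 / 2 : ℝ) (hg.add hg'), MemLp.toLp_add hg hg'] at e4
  simp only [Lp.toLp_coeFn] at e1 e2 e3 e4
  rw [e1, e2, e3, e4]
  have i1 := hg.integrable_norm_rpow hp0 hp_top
  have i2 := hg'.integrable_norm_rpow hp0 hp_top
  have i3 := (hg.sub hg').integrable_norm_rpow hp0 hp_top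
  have i4 := hs.integrable_norm_rpow hp0 hp_top
  have hmono := integral_mono i3
    (((i1.add i2).const_mul η).add ((((i1.add i2).div_const 2).sub i4).const_mul C))
    fun t => h (g t) (g' t)
  refine hmono.trans_eq ?_
  have j1 := integral_add ((i1.add i2).const_mul η)
    ((((i1.add i2).div_const 2).sub i4).const_mul C)
  have j2 := integral_sub ((i1.add i2).div_const 2) i4
  have j3 := integral_add i1 i2
  simp only [Pi.add_apply, Pi.sub_apply] at j1 j2 j3 ⊢
  rw [j1, integral_const_mul, integral_const_mul, j2, integral_div, j3]

/-- In a normed space with the convexity estimate `hX`, a bounded family whose norms and midpoint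
norms decrease under an upward shift `s`, and which is right-continuous in norm, is Cauchy at `0`:
midpoints of `U y` and `U y'` are almost as long as `U s`, hence almost as long as possible. -/
lemma cauchy_map_of_midpoint {X : Type*} [NormedAddCommGroup X] [NormedSpace ℝ X] {r : ℝ}
    (hr : 0 < r)
    (hX : ∀ η : ℝ, 0 < η → ∃ C : ℝ, 0 ≤ C ∧ ∀ g h : X, ‖g - h‖ ^ r ≤ η * (‖g‖ ^ r + ‖h‖ ^ r) +
      C * ((‖g‖ ^ r + ‖h‖ ^ r) / 2 - ‖(1 / 2 : ℝ) • (g + h)‖ ^ r))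
    {U : ℝ → X} {B : ℝ} (hB : ∀ y, 0 < y → ‖U y‖ ≤ B)
    (hmid : ∀ y y' s, 0 < y → 0 < y' → 0 < s →
      ‖(1 / 2 : ℝ) • (U (y + s) + U (y' + s))‖ ≤ ‖(1 / 2 : ℝ) • (U y + U y')‖)
    (hcont : ∀ s, 0 < s → Tendsto (fun y => U (y + s)) (𝓝[>] 0) (𝓝 (U s))) :
    Cauchy (map U (𝓝[>] 0)) := by
  rw [cauchy_map_iff']
  rw [Metric.uniformity_basis_dist.tendsto_right_iff]
  intro ε hε
  have hB0 : 0 ≤ B := (norm_nonneg _).trans (hB 1 one_pos)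
  set A : ℝ := B ^ r
  have hA : 0 ≤ A := by positivity
  have hn : ∀ y, 0 < y → ‖U y‖ ^ r ≤ A := fun y hy =>
    Real.rpow_le_rpow (norm_nonneg _) (hB y hy) hr.le
  set e : ℝ := ε ^ r
  have he : 0 < e := by positivity
  obtain ⟨C, hC, hconv⟩ := hX (e / (4 * (A + 1))) (by positivity)
  set T : Set ℝ := (fun y => ‖U y‖ ^ r) '' Set.Ioi 0
  have hTb : BddAbove T := ⟨A, by rintro _ ⟨y, hy, rfl⟩; exact hn y hy⟩
  have hTn : T.Nonempty := ⟨_, 1, Set.mem_Ioi.2 one_pos, rfl⟩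
  obtain ⟨_, ⟨s, hs, rfl⟩, hsT⟩ := exists_lt_of_lt_csSup hTn
    (show sSup T - e / (8 * (C + 1)) < sSup T by
      have : 0 < e / (8 * (C + 1)) := by positivity
      linarith)
  have hs0 : (0 : ℝ) < s := hs
  have hTle : ∀ y, 0 < y → ‖U y‖ ^ r ≤ sSup T := fun y hy => le_csSup hTb ⟨y, hy, rfl⟩
  have hlim : Tendsto (fun q : ℝ × ℝ => ‖(1 / 2 : ℝ) • (U (q.1 + s) + U (q.2 + s))‖ ^ r)
      (𝓝[>] 0 ×ˢ 𝓝[>] 0) (𝓝 (‖U s‖ ^ r)) := by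
    have h1 := ((((hcont s hs0).comp tendsto_fst).add
      ((hcont s hs0).comp (tendsto_snd (f := 𝓝[>] (0 : ℝ))))).const_smul (1 / 2 : ℝ)).norm.rpow_const
        (p := r) (Or.inr hr.le)
    have h2 : (1 / 2 : ℝ) • (U s + U s) = U s := by
      rw [← two_smul ℝ (U s), smul_smul]; norm_num
    rw [h2] at h1
    exact h1
  have hev := hlim.eventually (lt_mem_nhds (show ‖U s‖ ^ r - e / (8 * (C + 1)) < ‖U s‖ ^ r by
      have : 0 < e / (8 * (C + 1)) := by positivity
      linarith))
  have hpos₁ : ∀ᶠ y in 𝓝[>] (0 : ℝ), 0 < y := self_mem_nhdsWithin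
  have hpos : ∀ᶠ q : ℝ × ℝ in 𝓝[>] 0 ×ˢ 𝓝[>] 0, 0 < q.1 ∧ 0 < q.2 := hpos₁.prod_mk hpos₁
  filter_upwards [hev, hpos] with q hq hq0
  have hm := Real.rpow_le_rpow (norm_nonneg _) (hmid q.1 q.2 s hq0.1 hq0.2 hs0) hr.le
  have hc := hconv (U q.1) (U q.2)
  have h3 : (‖U q.1‖ ^ r + ‖U q.2‖ ^ r) / 2 - ‖(1 / 2 : ℝ) • (U q.1 + U q.2)‖ ^ r ≤
      e / (4 * (C + 1)) := by
    have e1 := hTle q.1 hq0.1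
    have e2 := hTle q.2 hq0.2
    have e3 : e / (4 * (C + 1)) = e / (8 * (C + 1)) + e / (8 * (C + 1)) := by
      field_simp; norm_num
    dsimp only at hsT
    linarith
  have h4 : C * ((‖U q.1‖ ^ r + ‖U q.2‖ ^ r) / 2 - ‖(1 / 2 : ℝ) • (U q.1 + U q.2)‖ ^ r) ≤
      e / 4 := by
    refine (mul_le_mul_of_nonneg_left h3 hC).trans ?_
    rw [← mul_div_assoc, div_le_div_iff₀ (by positivity) (by norm_num)]
    nlinarith
  have h5 : e / (4 * (A + 1)) * (‖U q.1‖ ^ r + ‖U q.2‖ ^ r) ≤ e / 2 := by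
    have : ‖U q.1‖ ^ r + ‖U q.2‖ ^ r ≤ 2 * A := by linarith [hn q.1 hq0.1, hn q.2 hq0.2]
    refine (mul_le_mul_of_nonneg_left this (by positivity)).trans ?_
    rw [div_mul_eq_mul_div, div_le_div_iff₀ (by positivity) (by norm_num)]
    nlinarith
  have h6 : ‖U q.1 - U q.2‖ ^ r < ε ^ r := by
    change _ < e
    linarith
  rw [dist_eq_norm]
  exact (Real.rpow_lt_rpow_iff (norm_nonneg _) hε.le hr).1 h6

lemma IsCauchyRepr.midpoint {E : Type*} [NormedAddCommGroup E] [NormedSpace ℂ E] {p : ℝ≥0∞}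
    (hp : 1 < p) (hp_top : p ≠ ∞) {F F' : ℂ → E} {f f' : ℝ → E} (hf : MemLp f p volume)
    (hf' : MemLp f' p volume) (h : IsCauchyRepr F f) (h' : IsCauchyRepr F' f') :
    IsCauchyRepr (fun z => (1 / 2 : ℝ) • (F z + F' z)) (fun t => (1 / 2 : ℝ) • (f t + f' t)) := by
  intro z hz
  have hz' : (starRingEnd ℂ z).im ≠ 0 := by simpa using hz.ne'
  have key : ∀ w : ℂ, w.im ≠ 0 → ∫ t : ℝ, ((t : ℂ) - w)⁻¹ • (1 / 2 : ℝ) • (f t + f' t) =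
      (1 / 2 : ℝ) • ((∫ t : ℝ, ((t : ℂ) - w)⁻¹ • f t) + ∫ t : ℝ, ((t : ℂ) - w)⁻¹ • f' t) := by
    intro w hw
    rw [← integral_add (integrable_cauchyKernel_smul hp hp_top hf hw)
      (integrable_cauchyKernel_smul hp hp_top hf' hw), ← integral_smul]
    refine integral_congr_ae (.of_forall fun t => ?_)
    dsimp only
    rw [smul_comm, smul_add]
  constructor
  · rw [key z hz.ne', (h z hz).1, (h' z hz).1, ← smul_add, smul_comm]
  · rw [key _ hz', (h z hz).2, (h' z hz).2, add_zero, smul_zero]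

/-- A scalar Hardy function is the Cauchy integral of an `L^p` function: its restrictions to the
lines `Im z = y` converge in `L^p` as `y → 0`. -/
theorem MemHardy.exists_isCauchyRepr_complex {p : ℝ≥0∞} (hp : 1 < p) (hp_top : p ≠ ∞) {F : ℂ → ℂ}
    (hF : MemHardy p F) :
    ∃ f : ℝ → ℂ, StronglyMeasurable f ∧ MemLp f p volume ∧ IsCauchyRepr F f := by
  have : Fact (1 ≤ p) := ⟨hp.le⟩
  have hr : 0 < p.toReal := ENNReal.toReal_pos (zero_lt_one.trans hp).ne' hp_top
  set u : ℝ → ℝ → ℂ := fun y t => F (t + y * Complex.I)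
  have hu : ∀ y, 0 < y → MemLp (u y) p volume := fun y hy => hF.memLp_line hy
  have hum : ∀ y, 0 < y → StronglyMeasurable (u y) := fun y hy =>
    (hF.continuous_line hy).stronglyMeasurable
  have hrep : ∀ y : ℝ, 0 < y → IsCauchyRepr (fun z => F (z + y * Complex.I)) (u y) := fun y hy =>
    hF.isCauchyRepr_line hp hp_top hy
  have hshift : ∀ y s : ℝ, ∀ x : ℝ, F (x + s * Complex.I + y * Complex.I) = u (y + s) x := by
    intro y s x
    simp only [u]
    congr 1
    push_cast
    ring
  set U : ℝ → Lp ℂ p (volume : Measure ℝ) := fun y =>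
    if hy : 0 < y then (hu y hy).toLp (u y) else 0
  have hU : ∀ y (hy : 0 < y), U y = (hu y hy).toLp (u y) := fun y hy => by
    simp only [U]
    rw [dif_pos hy]
  have hUmid : ∀ y y' (hy : 0 < y) (hy' : 0 < y'), ‖(1 / 2 : ℝ) • (U y + U y')‖ =
      (eLpNorm (fun t => (1 / 2 : ℝ) • (u y t + u y' t)) p volume).toReal := by
    intro y y' hy hy'
    rw [hU y hy, hU y' hy', ← MemLp.toLp_add, ← MemLp.toLp_const_smul, Lp.norm_toLp]
    rfl
  have hcauchy : Cauchy (map U (𝓝[>] 0)) := by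
    refine cauchy_map_of_midpoint hr (fun η hη => exists_norm_sub_rpow_le_Lp hp hp_top hη)
      (B := (⨆ (y : ℝ) (_ : 0 < y), eLpNorm (fun x : ℝ => F (x + y * Complex.I)) p volume).toReal)
      ?_ ?_ ?_
    · intro y hy
      rw [hU y hy, Lp.norm_toLp]
      exact ENNReal.toReal_mono hF.2.ne (eLpNorm_line_le_iSup p F hy)
    · intro y y' s hy hy' hs
      rw [hUmid y y' hy hy', hUmid (y + s) (y' + s) (by linarith) (by linarith)]
      have hmem : MemLp (fun t => (1 / 2 : ℝ) • (u y t + u y' t)) p volume :=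
        ((hu y hy).add (hu y' hy')).const_smul (1 / 2 : ℝ)
      refine ENNReal.toReal_mono hmem.2.ne ?_
      have h1 := ((hrep y hy).midpoint hp hp_top (hu y hy) (hu y' hy')
        (hrep y' hy')).eLpNorm_line_le hp hp_top hmem
          (((hum y hy).add (hum y' hy')).const_smul (1 / 2 : ℝ)) hs
      simpa only [hshift] using h1
    · intro s hs
      have h1 := (hrep s hs).tendsto_eLpNorm_sub hp hp_top (hu s hs) (hum s hs)
      rw [tendsto_iff_edist_tendsto_0]
      refine h1.congr' ?_
      filter_upwards [self_mem_nhdsWithin] with y hy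
      have hy0 : (0 : ℝ) < y := hy
      rw [hU s hs, hU (y + s) (by linarith), Lp.edist_toLp_toLp]
      simp only [hshift, add_comm s y]
      rfl
  obtain ⟨g, hg⟩ := CompleteSpace.complete hcauchy
  have hg' : Tendsto U (𝓝[>] 0) (𝓝 g) := hg
  have hgm : MemLp g p volume := Lp.memLp g
  refine ⟨g, Lp.stronglyMeasurable g, hgm, ?_⟩
  have hlim : Tendsto (fun y => eLpNorm (fun t => u y t - g t) p volume) (𝓝[>] 0) (𝓝 0) := by
    rw [tendsto_iff_edist_tendsto_0] at hg'
    refine hg'.congr' ?_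
    filter_upwards [self_mem_nhdsWithin] with y hy
    rw [hU y hy]
    conv_lhs => rw [← Lp.toLp_coeFn g hgm]
    rw [Lp.edist_toLp_toLp]
    rfl
  have hev : ∀ᶠ y in 𝓝[>] (0 : ℝ), MemLp (u y) p volume := by
    filter_upwards [self_mem_nhdsWithin] with y hy using hu y hy
  intro z hz
  have hz' : (starRingEnd ℂ z).im ≠ 0 := by simpa using hz.ne'
  constructor
  · have h1 := tendsto_integral_kernel_smul hp hp_top hev hgm hlim
      (measurable_inv_ofReal_sub z).aestronglyMeasurable (norm_inv_ofReal_sub_le hz.ne')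
    have h2 : Tendsto (fun y : ℝ => F (z + y * Complex.I)) (𝓝[>] 0) (𝓝 (F z)) := by
      have hopen : IsOpen {w : ℂ | 0 < w.im} := isOpen_lt continuous_const Complex.continuous_im
      have hc : ContinuousAt F z := hF.1.continuousOn.continuousAt (hopen.mem_nhds hz)
      refine hc.tendsto.comp ?_
      have : Tendsto (fun y : ℝ => z + y * Complex.I) (𝓝 0) (𝓝 (z + (0 : ℝ) * Complex.I)) :=
        (by fun_prop : Continuous fun y : ℝ => z + y * Complex.I).tendsto 0
      simp only [Complex.ofReal_zero, zero_mul, add_zero] at this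
      exact this.mono_left nhdsWithin_le_nhds
    refine tendsto_nhds_unique (h1.congr' ?_) (h2.const_smul (2 * Real.pi * Complex.I))
    filter_upwards [self_mem_nhdsWithin] with y hy
    exact (hrep y hy z hz).1
  · have h1 := tendsto_integral_kernel_smul hp hp_top hev hgm hlim
      (measurable_inv_ofReal_sub (starRingEnd ℂ z)).aestronglyMeasurable
      (norm_inv_ofReal_sub_le hz')
    refine tendsto_nhds_unique (h1.congr' ?_) tendsto_const_nhds
    filter_upwards [self_mem_nhdsWithin] with y hy
    exact (hrep y hy z hz).2

lemma MemHardy.clm_comp {E E' : Type*} [NormedAddCommGroup E] [NormedSpace ℂ E]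
    [NormedAddCommGroup E'] [NormedSpace ℂ E'] {p : ℝ≥0∞} {F : ℂ → E} (hF : MemHardy p F)
    (L : E →L[ℂ] E') : MemHardy p (fun z => L (F z)) := by
  refine ⟨L.differentiable.comp_differentiableOn hF.1, ?_⟩
  refine lt_of_le_of_lt ?_ (ENNReal.mul_lt_top (enorm_lt_top (x := ‖L‖)) hF.2)
  refine iSup₂_le fun y hy => ?_
  refine le_trans ?_ (mul_le_mul_right (eLpNorm_line_le_iSup p F hy) _)
  rw [← eLpNorm_const_smul]
  refine eLpNorm_mono fun x => ?_
  rw [Pi.smul_apply, norm_smul, norm_norm]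
  exact L.le_opNorm _

/-- In finite dimensions the coordinates of a Hardy function have boundary functions, which
assemble to a boundary function of the whole. -/
theorem MemHardy.exists_isCauchyRepr {E : Type*} [NormedAddCommGroup E] [NormedSpace ℂ E]
    [FiniteDimensional ℂ E] {p : ℝ≥0∞} (hp : 1 < p) (hp_top : p ≠ ∞) {F : ℂ → E}
    (hF : MemHardy p F) :
    ∃ f : ℝ → E, StronglyMeasurable f ∧ MemLp f p volume ∧ IsCauchyRepr F f := by
  let b := Module.finBasis ℂ E
  have hc : ∀ i, MemHardy p (fun z => (b.coord i).toContinuousLinearMap (F z)) := fun i =>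
    hF.clm_comp _
  choose f hfm hfp hfr using fun i => (hc i).exists_isCauchyRepr_complex hp hp_top
  have hcoord : ∀ v : E, ∑ i, (b.coord i).toContinuousLinearMap v • b i = v := fun v => by
    simp
  have key : ∀ w : ℂ, w.im ≠ 0 → ∫ t : ℝ, ((t : ℂ) - w)⁻¹ • ∑ i, f i t • b i =
      ∑ i, (∫ t : ℝ, ((t : ℂ) - w)⁻¹ • f i t) • b i := by
    intro w hw
    simp_rw [Finset.smul_sum, ← smul_assoc]
    rw [integral_finsetSum _ fun i _ =>
      (integrable_cauchyKernel_smul hp hp_top (hfp i) hw).smul_const _]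
    simp_rw [integral_smul_const]
  refine ⟨fun t => ∑ i, f i t • b i, ?_, ?_, fun z hz => ?_⟩
  · exact Finset.stronglyMeasurable_fun_sum _ fun i _ => (hfm i).smul_const _
  · refine memLp_finsetSum _ fun i _ => ?_
    have h1 := (ContinuousLinearMap.toSpanSingleton ℂ (b i)).comp_memLp' (hfp i)
    exact h1
  · have hz' : (starRingEnd ℂ z).im ≠ 0 := by simpa using hz.ne'
    constructor
    · rw [key z hz.ne']
      simp_rw [fun i => (hfr i z hz).1, smul_assoc]
      rw [← Finset.smul_sum, hcoord]
    · rw [key _ hz']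
      simp_rw [fun i => (hfr i z hz).2, zero_smul]
      simp

/-! ### Truncated Hilbert transforms -/

lemma measurableSet_excised {S : Set ℝ} (hS : S.Countable) (ε : ℝ) :
    MeasurableSet (excised S ε) := by
  have : excised S ε = ⋂ s ∈ S, {t | ε < |t - s|} := by ext t; simp [excised]
  rw [this]
  exact MeasurableSet.biInter hS fun s _ => measurableSet_lt measurable_const (by fun_prop)

lemma mem_excised_singleton {x ε t : ℝ} : t ∈ excised {x} ε ↔ ε < |t - x| := by simp [excised]

section Truncated

variable {E : Type*} [NormedAddCommGroup E] [NormedSpace ℂ E] {p : ℝ≥0∞} {F : ℂ → E} {f : ℝ → E}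

lemma integrableOn_excised (hp : 1 < p) (hp_top : p ≠ ∞) (hf : MemLp f p volume) (x : ℝ) {ε : ℝ}
    (hε : 0 < ε) : IntegrableOn (fun t => (t - x)⁻¹ • f t) (excised {x} ε) volume := by
  have hS := measurableSet_excised (Set.countable_singleton x) ε
  rw [← integrable_indicator_iff hS]
  have h1 : Integrable fun t => (excised {x} ε).indicator (fun t => (t - x)⁻¹) t • f t := by
    refine integrable_kernel_smul (C := (1 + |x|) / ε + 1) hp hp_top hf
      (((by fun_prop : Measurable fun t : ℝ => (t - x)⁻¹).indicator hS).aestronglyMeasurable)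
      fun t => ?_
    by_cases ht : t ∈ excised {x} ε
    · rw [Set.indicator_of_mem ht]
      have h2 : ε < |t - x| := mem_excised_singleton.1 ht
      have h3 : |t| ≤ |x| + |t - x| := by
        have := abs_add_le x (t - x); rwa [add_sub_cancel] at this
      rw [norm_inv, Real.norm_eq_abs, ← div_eq_mul_inv,
        inv_le_comm₀ (hε.trans h2) (by positivity), inv_div, div_le_iff₀ (by positivity)]
      have h4 : 1 + |x| ≤ |t - x| * ((1 + |x|) / ε) := by
        rw [← mul_div_assoc, le_div_iff₀ hε, mul_comm]
        gcongr
      linarith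
    · rw [Set.indicator_of_notMem ht, norm_zero]
      positivity
  refine h1.congr (.of_forall fun t => ?_)
  by_cases ht : t ∈ excised {x} ε
  · simp [Set.indicator_of_mem ht]
  · simp [Set.indicator_of_notMem ht]

/-- The kernel `1 / s`, truncated to `|s| > 1`. -/
noncomputable def truncKernel (s : ℝ) : ℝ := {s : ℝ | 1 < |s|}.indicator (fun s => s⁻¹) s

lemma measurable_truncKernel : Measurable truncKernel :=
  measurable_inv.indicator (measurableSet_lt measurable_const (by fun_prop))

lemma abs_truncKernel_le (s : ℝ) : |truncKernel s| ≤ 2 * (1 + |s|)⁻¹ := by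
  unfold truncKernel
  by_cases hs : 1 < |s|
  · rw [Set.indicator_of_mem (by exact hs), abs_inv, ← div_eq_mul_inv, inv_le_comm₀ (by linarith)
      (by positivity), inv_div, div_le_iff₀ (by positivity)]
    linarith
  · rw [Set.indicator_of_notMem (by exact hs), abs_zero]
    positivity

lemma truncKernel_neg (s : ℝ) : truncKernel (-s) = -truncKernel s := by
  unfold truncKernel
  by_cases hs : 1 < |s|
  · have h1 : 1 < |-s| := by rwa [abs_neg]
    rw [Set.indicator_of_mem (by exact h1), Set.indicator_of_mem (by exact hs), inv_neg]
  · have h1 : ¬ 1 < |-s| := by rwa [abs_neg]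
    rw [Set.indicator_of_notMem (by exact h1), Set.indicator_of_notMem (by exact hs), neg_zero]

lemma abs_truncKernel_sub_le (s : ℝ) :
    |truncKernel s - s * (1 + s ^ 2)⁻¹| ≤ 1 * (1 + s ^ 2)⁻¹ := by
  have h0 : 0 < 1 + s ^ 2 := by positivity
  unfold truncKernel
  by_cases hs : 1 < |s|
  · rw [Set.indicator_of_mem (by exact hs)]
    have hs0 : s ≠ 0 := fun h => by rw [h, abs_zero] at hs; linarith
    have h1 : s⁻¹ - s * (1 + s ^ 2)⁻¹ = s⁻¹ * (1 + s ^ 2)⁻¹ := by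
      field_simp
      ring
    rw [h1, abs_mul, abs_of_pos (inv_pos.2 h0), abs_inv]
    gcongr
    exact inv_le_one_of_one_le₀ hs.le
  · rw [Set.indicator_of_notMem (by exact hs), zero_sub, abs_neg, abs_mul,
      abs_of_pos (inv_pos.2 h0)]
    gcongr
    exact not_lt.1 hs

lemma integral_excised_eq_dilate (f : ℝ → E) (x : ℝ) {ε : ℝ} (hε : 0 < ε) :
    ∫ t in excised {x} ε, (t - x)⁻¹ • f t = ∫ s, truncKernel s • f (x + ε * s) := by
  rw [integral_kernel_comp_affine truncKernel f x hε,
    ← integral_indicator (measurableSet_excised (Set.countable_singleton x) ε)]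
  refine integral_congr_ae (.of_forall fun t => ?_)
  have hiff : t ∈ excised {x} ε ↔ 1 < |(t - x) / ε| := by
    rw [mem_excised_singleton, abs_div, abs_of_pos hε, lt_div_iff₀ hε, one_mul]
  unfold truncKernel
  by_cases ht : t ∈ excised {x} ε
  · rw [Set.indicator_of_mem ht]
    dsimp only
    rw [Set.indicator_of_mem (by exact hiff.1 ht)]
    congr 1
    field_simp
  · rw [Set.indicator_of_notMem ht]
    dsimp only
    rw [Set.indicator_of_notMem (by exact fun h => ht (hiff.2 h)), mul_zero, zero_smul]

variable [CompleteSpace E]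

/-- The truncated Hilbert transform differs from the conjugate Poisson integral at the same scale
by convolution with an odd kernel dominated by the Poisson kernel; the conjugate Poisson integral
is `i F`, since `f` is a boundary function. -/
lemma IsCauchyRepr.enorm_truncated_sub_le (hp : 1 < p) (hp_top : p ≠ ∞) (hf : MemLp f p volume)
    (hfm : StronglyMeasurable f) (h : IsCauchyRepr F f) (x : ℝ) {ε : ℝ} (hε : 0 < ε) :
    ‖(∫ t in excised {x} ε, (t - x)⁻¹ • f t) - (Real.pi * Complex.I) • f x‖ₑ ≤
      ENNReal.ofReal (3 * Real.pi) * poissonOsc f ε x := by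
  have hconj : ∀ s : ℝ, |s * (1 + s ^ 2)⁻¹| ≤ 2 * (1 + |s|)⁻¹ := fun s => by
    rw [abs_mul, abs_of_pos (by positivity : 0 < (1 + s ^ 2)⁻¹), ← div_eq_mul_inv,
      ← div_eq_mul_inv, div_le_div_iff₀ (by positivity) (by positivity)]
    nlinarith [sq_abs s, sq_nonneg (|s| - 1), abs_nonneg s]
  have hkm : Measurable fun s => truncKernel s - s * (1 + s ^ 2)⁻¹ :=
    measurable_truncKernel.sub (by fun_prop)
  have hodd : ∫ s, (truncKernel s - s * (1 + s ^ 2)⁻¹) = 0 := by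
    have h1 := integral_neg_eq_self (fun s => truncKernel s - s * (1 + s ^ 2)⁻¹)
      (volume : Measure ℝ)
    have h2 : ∀ s : ℝ, truncKernel (-s) - -s * (1 + (-s) ^ 2)⁻¹ =
        -(truncKernel s - s * (1 + s ^ 2)⁻¹) := fun s => by
      rw [truncKernel_neg, neg_sq]; ring
    simp_rw [h2] at h1
    rw [integral_neg] at h1
    linarith
  have h1 := enorm_integral_dilate_sub_le hp hp_top hf hfm hkm abs_truncKernel_sub_le x hε.ne'
  have i1 := integrable_dilate hp hp_top hf measurable_truncKernel abs_truncKernel_le x hε.ne'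
  have i2 := integrable_dilate hp hp_top hf
    (by fun_prop : Measurable fun s : ℝ => s * (1 + s ^ 2)⁻¹) hconj x hε.ne'
  simp_rw [sub_smul] at h1
  rw [hodd, zero_smul, sub_zero, integral_sub i1 i2,
    h.integral_conjPoisson_dilate hp hp_top hf x hε, ← integral_excised_eq_dilate f x hε] at h1
  have h2 := h.enorm_sub_le hp hp_top hf hfm x (a := 0) (b := 0) (by simp) hε
  simp only [zero_mul, add_zero, ne_eq, OfNat.ofNat_ne_zero, not_false_eq_true, zero_pow,
    mul_zero] at h2
  have h3 : ‖(Real.pi * Complex.I : ℂ)‖ₑ = ENNReal.ofReal Real.pi := by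
    rw [← ofReal_norm, norm_mul, Complex.norm_I, mul_one, Complex.norm_real,
      Real.norm_of_nonneg Real.pi_pos.le]
  calc _ = ‖((∫ t in excised {x} ε, (t - x)⁻¹ • f t) -
          (Real.pi * Complex.I) • F (x + ε * Complex.I)) +
        (Real.pi * Complex.I) • (F (x + ε * Complex.I) - f x)‖ₑ := by
        rw [smul_sub, sub_add_sub_cancel]
    _ ≤ ENNReal.ofReal (Real.pi * 1) * poissonOsc f ε x +
        ENNReal.ofReal Real.pi * (ENNReal.ofReal 2 * poissonOsc f ε x) := by
        refine (enorm_add_le _ _).trans (add_le_add h1 ?_)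
        rw [enorm_smul, h3]
        gcongr
    _ = _ := by
        rw [← mul_assoc, ← ENNReal.ofReal_mul Real.pi_pos.le, ← add_mul,
          ← ENNReal.ofReal_add (by positivity) (by positivity)]
        congr 2
        ring

end Truncated

/-! ### The Kramers-Kronig relation -/

section Star

variable {E : Type*} [NormedAddCommGroup E] [NormedSpace ℂ E] [StarAddMonoid E] [StarModule ℂ E]
  [NormedStarGroup E] {p : ℝ≥0∞} {F : ℂ → E} {f : ℝ → E}

lemma norm_imaginaryPart_le (v : E) : ‖(ℑ v : E)‖ ≤ ‖v‖ := by
  rw [imaginaryPart_apply_coe, norm_smul, norm_neg, Complex.norm_I, one_mul, norm_smul]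
  have := norm_sub_le v (star v)
  rw [norm_star] at this
  norm_num
  linarith

/-- The imaginary part `(a - a⋆) / (2 i)` as a continuous real-linear endomorphism. -/
noncomputable def imaginaryPartCLM (E : Type*) [NormedAddCommGroup E] [NormedSpace ℂ E]
    [StarAddMonoid E] [StarModule ℂ E] [NormedStarGroup E] : E →L[ℝ] E :=
  LinearMap.mkContinuous
    { toFun := fun v => (ℑ v : E)
      map_add' := fun v w => by simp
      map_smul' := fun c v => by simp } 1 fun v => by
        rw [one_mul]; exact norm_imaginaryPart_le v

lemma imaginaryPartCLM_apply (v : E) : imaginaryPartCLM E v = (ℑ v : E) := rfl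

omit [NormedStarGroup E] in
lemma imaginaryPart_pi_mul_I_smul (v : E) :
    (ℑ ((Real.pi * Complex.I) • v) : E) = Real.pi • (ℜ v : E) := by
  rw [mul_smul, Complex.coe_smul, map_smul, imaginaryPart_I_smul]
  rfl

lemma memLp_imaginaryPart (hf : MemLp f p volume) : MemLp (fun t => (ℑ (f t) : E)) p volume :=
  (imaginaryPartCLM E).comp_memLp' hf

lemma stronglyMeasurable_imaginaryPart (hf : StronglyMeasurable f) :
    StronglyMeasurable fun t => (ℑ (f t) : E) :=
  (imaginaryPartCLM E).continuous.comp_stronglyMeasurable hf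

variable [CompleteSpace E]

lemma integral_smul_imaginaryPart {μ : Measure ℝ} {k : ℝ → ℝ}
    (hk : Integrable (fun t => k t • f t) μ) :
    ∫ t, k t • (ℑ (f t) : E) ∂μ = (ℑ (∫ t, k t • f t ∂μ) : E) := by
  rw [← imaginaryPartCLM_apply, ← (imaginaryPartCLM E).integral_comp_comm hk]
  simp_rw [map_smul, imaginaryPartCLM_apply]

lemma IsCauchyRepr.enorm_truncated_imaginaryPart_sub_le (hp : 1 < p) (hp_top : p ≠ ∞)
    (hf : MemLp f p volume) (hfm : StronglyMeasurable f) (h : IsCauchyRepr F f) (x : ℝ) {ε : ℝ}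
    (hε : 0 < ε) :
    ‖(∫ t in excised {x} ε, (t - x)⁻¹ • (ℑ (f t) : E)) - Real.pi • (ℜ (f x) : E)‖ₑ ≤
      ENNReal.ofReal (3 * Real.pi) * poissonOsc f ε x := by
  refine le_trans ?_ (h.enorm_truncated_sub_le hp hp_top hf hfm x hε)
  rw [integral_smul_imaginaryPart (integrableOn_excised hp hp_top hf x hε),
    ← imaginaryPart_pi_mul_I_smul, ← imaginaryPartCLM_apply, ← imaginaryPartCLM_apply, ← map_sub,
    enorm_le_iff_norm_le, imaginaryPartCLM_apply]
  exact norm_imaginaryPart_le _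

lemma IsCauchyRepr.ae_tendsto_truncated (hp : 1 < p) (hp_top : p ≠ ∞)
    (hf : MemLp f p volume) (hfm : StronglyMeasurable f) (h : IsCauchyRepr F f) :
    ∀ᵐ x : ℝ, Tendsto (fun ε : ℝ => ∫ t in excised {x} ε, (t - x)⁻¹ • (ℑ (f t) : E)) (𝓝[>] 0)
      (𝓝 (Real.pi • (ℜ (f x) : E))) := by
  filter_upwards [ae_tendsto_poissonOsc hp.le hp_top hf hfm] with x hx
  rw [tendsto_iff_edist_tendsto_0]
  have h1 := ENNReal.Tendsto.const_mul (a := ENNReal.ofReal (3 * Real.pi)) hx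
    (Or.inr ENNReal.ofReal_ne_top)
  rw [mul_zero] at h1
  refine tendsto_of_tendsto_of_tendsto_of_le_of_le' tendsto_const_nhds h1
    (.of_forall fun _ => zero_le) ?_
  filter_upwards [self_mem_nhdsWithin] with ε hε
  rw [edist_eq_enorm_sub]
  exact h.enorm_truncated_imaginaryPart_sub_le hp hp_top hf hfm x hε

theorem IsCauchyRepr.pvKramersKronig (hp : 1 < p) (hp_top : p ≠ ∞)
    (hf : MemLp f p volume) (hfm : StronglyMeasurable f) (h : IsCauchyRepr F f) :
    PVKramersKronig p f := by
  constructor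
  · filter_upwards [h.ae_tendsto_truncated hp hp_top hf hfm] with x hx
    refine ⟨Real.pi • (ℜ (f x) : E), ⟨fun ε hε =>
      integrableOn_excised hp hp_top (memLp_imaginaryPart hf) x hε, hx⟩, ?_⟩
    rw [smul_smul, one_div, inv_mul_cancel₀ Real.pi_pos.ne', one_smul]
  · refine tendsto_eLpNorm_of_enorm_le_poissonOsc
      (C := ‖1 / Real.pi‖ₑ * ENNReal.ofReal (3 * Real.pi)) hp.le hp_top hf hfm
      (ENNReal.mul_ne_top enorm_ne_top ENNReal.ofReal_ne_top) fun ε hε x => ?_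
    have h1 : (ℜ (f x) : E) = (1 / Real.pi) • Real.pi • (ℜ (f x) : E) := by
      rw [smul_smul, one_div, inv_mul_cancel₀ Real.pi_pos.ne', one_smul]
    rw [h1, ← smul_sub, enorm_smul, mul_assoc]
    gcongr
    exact h.enorm_truncated_imaginaryPart_sub_le hp hp_top hf hfm x hε

end Star

/-! ### Principal values and conjugate Poisson integrals -/

lemma integral_two_mul_div_sq {ρ : ℝ} (hρ : 0 ≤ ρ) :
    ∫ s in Set.Ioo 0 ρ, 2 * s * ((1 + s ^ 2) ^ 2)⁻¹ = ρ ^ 2 * (1 + ρ ^ 2)⁻¹ := by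
  rw [← integral_Ioc_eq_integral_Ioo, ← intervalIntegral.integral_of_le hρ]
  rw [intervalIntegral.integral_eq_sub_of_hasDerivAt (f := fun s => -(1 + s ^ 2)⁻¹)]
  · have : 1 + ρ ^ 2 ≠ 0 := by positivity
    field_simp
    ring
  · intro s _
    have h0 : 1 + s ^ 2 ≠ 0 := by positivity
    have h1 := (((hasDerivAt_pow 2 s).const_add 1).inv h0).neg
    refine h1.congr_deriv ?_
    push_cast
    field_simp
  · refine Continuous.intervalIntegrable ?_ _ _
    refine Continuous.mul (by fun_prop) (Continuous.inv₀ (by fun_prop) fun s => ?_)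
    positivity

lemma integrableOn_two_mul_div_sq :
    IntegrableOn (fun s : ℝ => 2 * s * ((1 + s ^ 2) ^ 2)⁻¹) (Set.Ioi 0) ∧
      ∫ s in Set.Ioi (0 : ℝ), 2 * s * ((1 + s ^ 2) ^ 2)⁻¹ = 1 := by
  have hd : ∀ s ∈ Set.Ici (0 : ℝ), HasDerivAt (fun s : ℝ => -(1 + s ^ 2)⁻¹)
      (2 * s * ((1 + s ^ 2) ^ 2)⁻¹) s := by
    intro s _
    have h0 : 1 + s ^ 2 ≠ 0 := by positivity
    have h1 := (((hasDerivAt_pow 2 s).const_add 1).inv h0).neg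
    refine h1.congr_deriv ?_
    push_cast
    field_simp
  have hpos : ∀ s ∈ Set.Ioi (0 : ℝ), 0 ≤ 2 * s * ((1 + s ^ 2) ^ 2)⁻¹ := fun s hs => by
    have : (0 : ℝ) < s := hs
    positivity
  have hlim : Tendsto (fun s : ℝ => -(1 + s ^ 2)⁻¹) atTop (𝓝 0) := by
    have h1 : Tendsto (fun s : ℝ => 1 + s ^ 2) atTop atTop :=
      tendsto_atTop_add_const_left _ _ (tendsto_pow_atTop two_ne_zero)
    simpa using h1.inv_tendsto_atTop.neg
  refine ⟨integrableOn_Ioi_deriv_of_nonneg' hd hpos hlim, ?_⟩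
  rw [integral_Ioi_of_hasDerivAt_of_nonneg' hd hpos hlim]
  norm_num

section Abel

variable {E : Type*} [NormedAddCommGroup E] [NormedSpace ℂ E] {p : ℝ≥0∞} {g : ℝ → E}

/-- The kernel of the double integral that writes a conjugate Poisson integral, over `t`, as an
average of truncated Hilbert transforms, over the truncation radii `y s`. -/
noncomputable def abelKernel (x y s t : ℝ) : ℝ :=
  {q : ℝ × ℝ | y * q.1 < |q.2 - x|}.indicator
    (fun q => 2 * q.1 * ((1 + q.1 ^ 2) ^ 2)⁻¹ * (q.2 - x)⁻¹) (s, t)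

lemma measurable_abelKernel (x y : ℝ) : Measurable fun q : ℝ × ℝ => abelKernel x y q.1 q.2 :=
  Measurable.indicator (by fun_prop) (measurableSet_lt (by fun_prop) (by fun_prop))

lemma abelKernel_eq_left (x y s t : ℝ) :
    abelKernel x y s t = 2 * s * ((1 + s ^ 2) ^ 2)⁻¹ *
      (excised {x} (y * s)).indicator (fun t => (t - x)⁻¹) t := by
  unfold abelKernel
  by_cases h : y * s < |t - x|
  · rw [Set.indicator_of_mem (by exact h), Set.indicator_of_mem (mem_excised_singleton.2 h)]
  · rw [Set.indicator_of_notMem (by exact h),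
      Set.indicator_of_notMem (fun h' => h (mem_excised_singleton.1 h')), mul_zero]

lemma abelKernel_eq_right (x : ℝ) {y : ℝ} (hy : 0 < y) {s : ℝ} (hs : 0 < s) (t : ℝ) :
    abelKernel x y s t = (Set.Ioo 0 (|t - x| / y)).indicator
      (fun s => 2 * s * ((1 + s ^ 2) ^ 2)⁻¹) s * (t - x)⁻¹ := by
  unfold abelKernel
  by_cases h : y * s < |t - x|
  · rw [Set.indicator_of_mem (by exact h),
      Set.indicator_of_mem (Set.mem_Ioo.2 ⟨hs, by rwa [lt_div_iff₀ hy, mul_comm]⟩)]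
  · rw [Set.indicator_of_notMem (by exact h), Set.indicator_of_notMem (fun h' => h (by
      have := h'.2; rwa [lt_div_iff₀ hy, mul_comm] at this)), zero_mul]

lemma setIntegral_abelKernel (x : ℝ) {y : ℝ} (hy : 0 < y) (t : ℝ) :
    ∫ s in Set.Ioi 0, abelKernel x y s t = (t - x) * ((t - x) ^ 2 + y ^ 2)⁻¹ := by
  rw [setIntegral_congr_fun measurableSet_Ioi fun s hs => abelKernel_eq_right x hy hs t,
    integral_mul_const, setIntegral_indicator measurableSet_Ioo,
    Set.inter_eq_right.2 Set.Ioo_subset_Ioi_self, integral_two_mul_div_sq (by positivity), div_pow,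
    sq_abs]
  have h1 : (t - x) ^ 2 + y ^ 2 ≠ 0 := by positivity
  have h2 : 1 + (t - x) ^ 2 / y ^ 2 ≠ 0 := by positivity
  rcases eq_or_ne (t - x) 0 with h0 | h0
  · simp [h0]
  · field_simp
    ring

lemma abs_abelKernel (x : ℝ) {y : ℝ} (hy : 0 < y) {s : ℝ} (hs : 0 < s) (t : ℝ) :
    |abelKernel x y s t| = (Set.Ioo 0 (|t - x| / y)).indicator
      (fun s => 2 * s * ((1 + s ^ 2) ^ 2)⁻¹) s * |t - x|⁻¹ := by
  rw [abelKernel_eq_right x hy hs, abs_mul, abs_inv, abs_of_nonneg]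
  refine Set.indicator_nonneg (fun r hr => ?_) s
  have := hr.1
  positivity

lemma setIntegral_abs_abelKernel (x : ℝ) {y : ℝ} (hy : 0 < y) (t : ℝ) :
    ∫ s in Set.Ioi 0, |abelKernel x y s t| = |t - x| * ((t - x) ^ 2 + y ^ 2)⁻¹ := by
  rw [setIntegral_congr_fun measurableSet_Ioi fun s hs => abs_abelKernel x hy hs t,
    integral_mul_const, setIntegral_indicator measurableSet_Ioo,
    Set.inter_eq_right.2 Set.Ioo_subset_Ioi_self, integral_two_mul_div_sq (by positivity), div_pow,
    sq_abs]
  have h1 : (t - x) ^ 2 + y ^ 2 ≠ 0 := by positivity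
  have h2 : 1 + (t - x) ^ 2 / y ^ 2 ≠ 0 := by positivity
  rcases eq_or_ne (t - x) 0 with h0 | h0
  · simp [h0]
  · have h3 : |t - x| ≠ 0 := abs_ne_zero.2 h0
    rw [← sq_abs (t - x)] at *
    field_simp
    ring

lemma integrableOn_abelKernel (x : ℝ) {y : ℝ} (hy : 0 < y) (t : ℝ) :
    IntegrableOn (fun s => abelKernel x y s t) (Set.Ioi 0) := by
  have h1 : IntegrableOn (fun s => (Set.Ioo 0 (|t - x| / y)).indicator
      (fun s => 2 * s * ((1 + s ^ 2) ^ 2)⁻¹) s * (t - x)⁻¹) (Set.Ioi 0) :=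
    (integrableOn_two_mul_div_sq.1.indicator measurableSet_Ioo).mul_const _
  exact h1.congr_fun (fun s hs => (abelKernel_eq_right x hy hs t).symm) measurableSet_Ioi

lemma abs_conjPoissonKernel_le (x : ℝ) {y : ℝ} (hy : 0 < y) (t : ℝ) :
    |t - x| * ((t - x) ^ 2 + y ^ 2)⁻¹ ≤ ((1 + |x|) / y + 1) * (1 + |t|)⁻¹ := by
  have h1 := norm_inv_sub_le (z := x + y * Complex.I) (η := y) (y := 0) hy
    (by simpa using le_abs_self y) t
  have hre : ((x : ℂ) + y * Complex.I).re = x := by simp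
  rw [hre] at h1
  refine le_trans ?_ h1
  set w : ℂ := (t : ℂ) + (0 : ℝ) * Complex.I - (x + y * Complex.I)
  have hw : ‖w‖ ^ 2 = (t - x) ^ 2 + y ^ 2 := by
    rw [← Complex.normSq_eq_norm_sq, Complex.normSq_apply]
    simp only [w, Complex.sub_re, Complex.add_re, Complex.ofReal_re, Complex.mul_re, Complex.I_re,
      Complex.ofReal_im, Complex.I_im, Complex.sub_im, Complex.add_im, Complex.mul_im]
    ring
  have h2 : |t - x| ≤ ‖w‖ := abs_le_of_sq_le_sq (by rw [hw]; nlinarith) (norm_nonneg _)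
  rw [← hw, norm_inv, pow_two, mul_inv, ← mul_assoc]
  refine mul_le_of_le_one_left (by positivity) ?_
  rw [← div_eq_mul_inv]
  exact div_le_one_of_le₀ h2 (norm_nonneg _)

lemma integrable_abelKernel_smul (hp : 1 < p) (hp_top : p ≠ ∞) (hg : MemLp g p volume)
    (hgm : StronglyMeasurable g) (x : ℝ) {y : ℝ} (hy : 0 < y) :
    Integrable (fun q : ℝ × ℝ => abelKernel x y q.1 q.2 • g q.2)
      ((volume.restrict (Set.Ioi 0)).prod volume) := by
  have hm : StronglyMeasurable fun q : ℝ × ℝ => abelKernel x y q.1 q.2 • g q.2 :=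
    (measurable_abelKernel x y).stronglyMeasurable.smul (hgm.comp_measurable measurable_snd)
  rw [integrable_prod_iff' hm.aestronglyMeasurable]
  refine ⟨.of_forall fun t => (integrableOn_abelKernel x hy t).smul_const (g t), ?_⟩
  simp_rw [norm_smul, integral_mul_const, Real.norm_eq_abs, setIntegral_abs_abelKernel x hy]
  have h1 := (integrable_kernel_smul (k := fun t => |t - x| * ((t - x) ^ 2 + y ^ 2)⁻¹)
    (C := (1 + |x|) / y + 1) hp hp_top hg
    (by fun_prop : Measurable fun t : ℝ => |t - x| * ((t - x) ^ 2 + y ^ 2)⁻¹).aestronglyMeasurable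
    fun t => by
      rw [Real.norm_of_nonneg (by positivity)]
      exact abs_conjPoissonKernel_le x hy t).norm
  refine h1.congr (.of_forall fun t => ?_)
  dsimp only
  rw [norm_smul, Real.norm_of_nonneg (by positivity)]

lemma integral_abelKernel_smul (g : ℝ → E) (x y s : ℝ) :
    ∫ t, abelKernel x y s t • g t = (2 * s * ((1 + s ^ 2) ^ 2)⁻¹) •
      ∫ t in excised {x} (y * s), (t - x)⁻¹ • g t := by
  have hS := measurableSet_excised (Set.countable_singleton x) (y * s)
  rw [← integral_indicator hS, ← integral_smul]
  refine integral_congr_ae (.of_forall fun t => ?_)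
  dsimp only
  rw [abelKernel_eq_left, mul_smul]
  congr 1
  by_cases ht : t ∈ excised {x} (y * s)
  · simp only [Set.indicator_of_mem ht]
  · simp only [Set.indicator_of_notMem ht, zero_smul]

variable [CompleteSpace E]

/-- The conjugate Poisson integral as an average of truncated Hilbert transforms. -/
lemma integral_conjPoisson_eq_integral_truncated (hp : 1 < p) (hp_top : p ≠ ∞)
    (hg : MemLp g p volume) (hgm : StronglyMeasurable g) (x : ℝ) {y : ℝ} (hy : 0 < y) :
    ∫ t, ((t - x) * ((t - x) ^ 2 + y ^ 2)⁻¹) • g t =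
      ∫ s in Set.Ioi (0 : ℝ), (2 * s * ((1 + s ^ 2) ^ 2)⁻¹) •
        ∫ t in excised {x} (y * s), (t - x)⁻¹ • g t := by
  have h1 := integral_integral_swap (f := fun s t => abelKernel x y s t • g t)
    (integrable_abelKernel_smul hp hp_top hg hgm x hy)
  simp_rw [integral_abelKernel_smul, integral_smul_const, setIntegral_abelKernel x hy] at h1
  exact h1.symm

/-- If the principal value at `x` exists, then the conjugate Poisson integrals at `x` converge to
it: an Abelian theorem. No regularity of `g` at `x` is used. -/
lemma tendsto_conjPoisson_of_tendsto_truncated (hp : 1 < p) (hp_top : p ≠ ∞)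
    (hg : MemLp g p volume) (hgm : StronglyMeasurable g) (x : ℝ) {M : E}
    (hM : Tendsto (fun ε : ℝ => ∫ t in excised {x} ε, (t - x)⁻¹ • g t) (𝓝[>] 0) (𝓝 M)) :
    Tendsto (fun y : ℝ => ∫ t, ((t - x) * ((t - x) ^ 2 + y ^ 2)⁻¹) • g t) (𝓝[>] 0) (𝓝 M) := by
  set T : ℝ → E := fun ε => ∫ t in excised {x} ε, (t - x)⁻¹ • g t
  obtain ⟨B, hB⟩ : ∃ B : ℝ, ∀ r, 0 < r → ‖T r‖ ≤ B := by
    have h1 : ∀ᶠ r in 𝓝[>] (0 : ℝ), ‖T r‖ < ‖M‖ + 1 :=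
      hM.norm.eventually (gt_mem_nhds (by linarith))
    obtain ⟨r₀, hr₀, h⟩ := mem_nhdsGT_iff_exists_Ioc_subset.1 h1
    have hr₀' : (0 : ℝ) < r₀ := hr₀
    have hi := integrableOn_excised hp hp_top hg x hr₀'
    refine ⟨max (‖M‖ + 1) (∫ t in excised {x} r₀, ‖(t - x)⁻¹ • g t‖), fun r hr => ?_⟩
    rcases le_total r r₀ with hle | hle
    · exact (h ⟨hr, hle⟩).le.trans (le_max_left _ _)
    · refine (norm_integral_le_integral_norm _).trans (le_trans ?_ (le_max_right _ _))
      refine setIntegral_mono_set hi.norm (.of_forall fun t => norm_nonneg _) ?_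
      refine (show excised {x} r ⊆ excised {x} r₀ from fun t ht => ?_).eventuallyLE
      rw [mem_excised_singleton] at ht ⊢
      linarith
  have hlim : Tendsto (fun y : ℝ => ∫ s in Set.Ioi (0 : ℝ),
      (2 * s * ((1 + s ^ 2) ^ 2)⁻¹) • T (y * s)) (𝓝[>] 0)
      (𝓝 (∫ s in Set.Ioi (0 : ℝ), (2 * s * ((1 + s ^ 2) ^ 2)⁻¹) • M)) := by
    refine tendsto_integral_filter_of_dominated_convergence
      (fun s => 2 * s * ((1 + s ^ 2) ^ 2)⁻¹ * B) ?_ ?_ ?_ ?_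
    · filter_upwards [self_mem_nhdsWithin] with y hy
      have h1 := (integrable_abelKernel_smul hp hp_top hg hgm x hy).integral_prod_left
      simp_rw [integral_abelKernel_smul] at h1
      exact h1.1
    · filter_upwards [self_mem_nhdsWithin] with y hy
      have hy0 : (0 : ℝ) < y := hy
      filter_upwards [ae_restrict_mem measurableSet_Ioi] with s hs
      have hs0 : (0 : ℝ) < s := hs
      rw [norm_smul, Real.norm_of_nonneg (by positivity)]
      gcongr
      exact hB _ (by positivity)
    · exact integrableOn_two_mul_div_sq.1.mul_const B
    · filter_upwards [ae_restrict_mem measurableSet_Ioi] with s hs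
      have hs0 : (0 : ℝ) < s := hs
      refine (hM.comp ?_).const_smul _
      refine tendsto_nhdsWithin_iff.2 ⟨?_, ?_⟩
      · have : Tendsto (fun y : ℝ => y * s) (𝓝 0) (𝓝 (0 * s)) := (continuous_mul_const s).tendsto 0
        rw [zero_mul] at this
        exact this.mono_left nhdsWithin_le_nhds
      · filter_upwards [self_mem_nhdsWithin] with y hy
        exact Set.mem_Ioi.2 (mul_pos hy hs0)
  rw [integral_smul_const, integrableOn_two_mul_div_sq.2, one_smul] at hlim
  refine hlim.congr' ?_
  filter_upwards [self_mem_nhdsWithin] with y hy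
  exact (integral_conjPoisson_eq_integral_truncated hp hp_top hg hgm x hy).symm

end Abel

/-! ### The once-subtracted relation -/

section TwoPoints

variable {E : Type*} [NormedAddCommGroup E] [NormedSpace ℂ E] {p : ℝ≥0∞} {g : ℝ → E}

lemma mem_excised_pair {a b ε t : ℝ} : t ∈ excised {a, b} ε ↔ ε < |t - a| ∧ ε < |t - b| := by
  simp [excised]

lemma integrableOn_excised_pair (hp : 1 < p) (hp_top : p ≠ ∞) (hg : MemLp g p volume) {a b : ℝ}
    (hab : b ≠ a) {ε : ℝ} (hε : 0 < ε) :
    IntegrableOn (fun t => ((t - a) * (t - b))⁻¹ • g t) (excised {a, b} ε) ∧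
      (b - a) • ∫ t in excised {a, b} ε, ((t - a) * (t - b))⁻¹ • g t =
        (∫ t in excised {a, b} ε, (t - b)⁻¹ • g t) - ∫ t in excised {a, b} ε, (t - a)⁻¹ • g t := by
  have hS := measurableSet_excised (Set.countable_singleton b |>.insert a) ε
  have ha := (integrableOn_excised hp hp_top hg a hε).mono_set
    (show excised {a, b} ε ⊆ excised {a} ε from fun t ht =>
      mem_excised_singleton.2 (mem_excised_pair.1 ht).1)
  have hb := (integrableOn_excised hp hp_top hg b hε).mono_set
    (show excised {a, b} ε ⊆ excised {b} ε from fun t ht =>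
      mem_excised_singleton.2 (mem_excised_pair.1 ht).2)
  have hba : b - a ≠ 0 := sub_ne_zero.2 hab
  have hfrac : ∀ t ∈ excised {a, b} ε, ((t - a) * (t - b))⁻¹ • g t =
      (b - a)⁻¹ • ((t - b)⁻¹ • g t - (t - a)⁻¹ • g t) := by
    intro t ht
    have h1 : t - a ≠ 0 := abs_pos.1 (hε.trans (mem_excised_pair.1 ht).1)
    have h2 : t - b ≠ 0 := abs_pos.1 (hε.trans (mem_excised_pair.1 ht).2)
    rw [← sub_smul, smul_smul]
    congr 1
    field_simp
    ring
  refine ⟨IntegrableOn.congr_fun ((hb.sub ha).smul (b - a)⁻¹) (fun t ht => (hfrac t ht).symm) hS, ?_⟩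
  rw [setIntegral_congr_fun hS hfrac, integral_smul, smul_smul, mul_inv_cancel₀ hba, one_smul,
    integral_sub hb ha]

/-- Excising a second point `a`, away from the singularity `b`, does not affect the limit of the
truncated integrals. -/
lemma tendsto_truncated_sub_excised_pair (hp : 1 < p) (hp_top : p ≠ ∞) (hg : MemLp g p volume)
    {a b : ℝ} (hab : b ≠ a) :
    Tendsto (fun ε : ℝ => (∫ t in excised {b} ε, (t - b)⁻¹ • g t) -
      ∫ t in excised {a, b} ε, (t - b)⁻¹ • g t) (𝓝[>] 0) (𝓝 0) := by
  have hd : 0 < |b - a| / 2 := by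
    have := abs_pos.2 (sub_ne_zero.2 hab)
    positivity
  set d := |b - a| / 2
  have hi := integrableOn_excised hp hp_top hg b hd
  have hSd := measurableSet_excised (Set.countable_singleton b) d
  have hi' := (integrable_indicator_iff hSd).2 hi
  have hvol : Tendsto (fun ε : ℝ => volume (Metric.closedBall a ε ∩ excised {b} ε)) (𝓝[>] 0)
      (𝓝 0) := by
    have h1 : Tendsto (fun ε : ℝ => ENNReal.ofReal (2 * ε)) (𝓝[>] 0) (𝓝 0) := by
      have h2 : Tendsto (fun ε : ℝ => ENNReal.ofReal (2 * ε)) (𝓝 0) (𝓝 (ENNReal.ofReal (2 * 0))) :=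
        (ENNReal.continuous_ofReal.comp (continuous_const_mul 2)).tendsto 0
      rw [mul_zero, ENNReal.ofReal_zero] at h2
      exact h2.mono_left nhdsWithin_le_nhds
    refine tendsto_of_tendsto_of_tendsto_of_le_of_le tendsto_const_nhds h1
      (fun _ => zero_le) fun ε => ?_
    exact (measure_mono Set.inter_subset_left).trans_eq (Real.volume_closedBall a ε)
  refine (hi'.tendsto_setIntegral_nhds_zero hvol).congr' ?_
  filter_upwards [Ioo_mem_nhdsGT hd] with ε hε
  have hS := measurableSet_excised (Set.countable_singleton b) ε
  have hS2 := measurableSet_excised (Set.countable_singleton b |>.insert a) ε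
  have hsub : excised {a, b} ε ⊆ excised {b} ε := fun t ht =>
    mem_excised_singleton.2 (mem_excised_pair.1 ht).2
  rw [← setIntegral_sdiff hS2 (integrableOn_excised hp hp_top hg b hε.1) hsub]
  have hset : excised {b} ε \ excised {a, b} ε = Metric.closedBall a ε ∩ excised {b} ε := by
    ext t
    simp only [Set.mem_sdiff, mem_excised_singleton, mem_excised_pair, Set.mem_inter_iff,
      Metric.mem_closedBall, Real.dist_eq, not_and, not_lt]
    constructor
    · rintro ⟨h1, h2⟩
      exact ⟨not_lt.1 fun h => absurd h1 (not_lt.2 (h2 h)), h1⟩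
    · rintro ⟨h1, h2⟩
      exact ⟨h2, fun h => absurd h1 (not_le.2 h)⟩
  rw [hset]
  refine setIntegral_congr_fun (Metric.isClosed_closedBall.measurableSet.inter hS) fun t ht => ?_
  have h1 : |t - a| ≤ ε := by simpa [Real.dist_eq] using ht.1
  have h2 : |b - a| ≤ |t - b| + |t - a| := by
    have := abs_sub_le b t a
    rwa [abs_sub_comm b t] at this
  have h3 : t ∈ excised {b} d := mem_excised_singleton.2 (by
    have h4 : |b - a| = 2 * d := by simp only [d]; ring
    linarith [hε.2])
  exact Set.indicator_of_mem h3 _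

/-- Partial fractions: up to an error that vanishes with `ε`, the truncated integrals with two
singular points are differences of truncated Hilbert transforms. -/
lemma tendsto_smul_excised_pair_sub (hp : 1 < p) (hp_top : p ≠ ∞) (hg : MemLp g p volume)
    {a b : ℝ} (hab : b ≠ a) :
    Tendsto (fun ε : ℝ => (b - a) • (∫ t in excised {a, b} ε, ((t - a) * (t - b))⁻¹ • g t) -
      ((∫ t in excised {b} ε, (t - b)⁻¹ • g t) - ∫ t in excised {a} ε, (t - a)⁻¹ • g t))
      (𝓝[>] 0) (𝓝 0) := by
  have h1 := tendsto_truncated_sub_excised_pair hp hp_top hg hab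
  have h2 := tendsto_truncated_sub_excised_pair hp hp_top hg hab.symm
  rw [Set.pair_comm] at h2
  have h3 := h2.sub h1
  rw [sub_zero] at h3
  refine h3.congr' ?_
  filter_upwards [self_mem_nhdsWithin] with ε hε
  rw [(integrableOn_excised_pair hp hp_top hg hab hε).2]
  abel

end TwoPoints

section Subtracted

variable {E : Type*} [NormedAddCommGroup E] [NormedSpace ℂ E] [StarAddMonoid E] [StarModule ℂ E]
  [NormedStarGroup E] [CompleteSpace E] {p : ℝ≥0∞} {F : ℂ → E} {f : ℝ → E}

/-- If `F` has a vertical limit `A` at `x` and the principal value of `ℑ f` at `x` exists, then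
that principal value is `π ℜ A`: both are limits of the conjugate Poisson integral of `ℑ f`,
which is `π ℜ F`. -/
lemma IsCauchyRepr.eq_of_tendsto_truncated (hp : 1 < p) (hp_top : p ≠ ∞) (hf : MemLp f p volume)
    (hfm : StronglyMeasurable f) (h : IsCauchyRepr F f) {x : ℝ} {A M : E}
    (hA : Tendsto (fun y : ℝ => F (x + y * Complex.I)) (𝓝[>] 0) (𝓝 A))
    (hM : Tendsto (fun ε : ℝ => ∫ t in excised {x} ε, (t - x)⁻¹ • (ℑ (f t) : E)) (𝓝[>] 0)
      (𝓝 M)) : M = Real.pi • (ℜ A : E) := by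
  refine tendsto_nhds_unique (tendsto_conjPoisson_of_tendsto_truncated hp hp_top
    (memLp_imaginaryPart hf) (stronglyMeasurable_imaginaryPart hfm) x hM) ?_
  have h1 := ((imaginaryPartCLM E).continuous.tendsto _).comp
    (hA.const_smul (Real.pi * Complex.I : ℂ))
  rw [imaginaryPartCLM_apply, imaginaryPart_pi_mul_I_smul] at h1
  refine h1.congr' ?_
  filter_upwards [self_mem_nhdsWithin] with y hy
  have hy0 : (0 : ℝ) < y := hy
  have h2 := h.integral_conjPoisson hp hp_top hf (z := x + y * Complex.I) (by simpa using hy0)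
  have hre : ((x : ℂ) + y * Complex.I).re = x := by simp
  have him : ((x : ℂ) + y * Complex.I).im = y := by simp
  rw [hre, him] at h2
  have hi : Integrable fun t => ((t - x) * ((t - x) ^ 2 + y ^ 2)⁻¹) • f t :=
    integrable_kernel_smul (C := (1 + |x|) / y + 1) hp hp_top hf
      (by fun_prop : Measurable fun t : ℝ =>
        (t - x) * ((t - x) ^ 2 + y ^ 2)⁻¹).aestronglyMeasurable fun t => by
      rw [norm_mul, Real.norm_eq_abs, Real.norm_of_nonneg (by positivity)]
      exact abs_conjPoissonKernel_le x hy0 t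
  rw [integral_smul_imaginaryPart hi, h2]
  rfl

theorem IsCauchyRepr.subtractedKramersKronig (hp : 1 < p) (hp_top : p ≠ ∞)
    (hf : MemLp f p volume) (hfm : StronglyMeasurable f) (h : IsCauchyRepr F f) :
    SubtractedKramersKronig F f := by
  intro ω₀ A hA
  have hg := memLp_imaginaryPart hf
  have hne : ∀ᵐ ω : ℝ, ω ≠ ω₀ := by
    simp [ae_iff]
  constructor
  · filter_upwards [hne, h.ae_tendsto_truncated hp hp_top hf hfm] with ω hω hT L hL
    have h1 := tendsto_smul_excised_pair_sub hp hp_top hg hω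
    -- The truncated Hilbert transforms at `ω₀` converge because everything else does.
    have h2 : Tendsto (fun ε : ℝ => ∫ t in excised {ω₀} ε, (t - ω₀)⁻¹ • (ℑ (f t) : E)) (𝓝[>] 0)
        (𝓝 (0 - ((ω - ω₀) • L - Real.pi • (ℜ (f ω) : E)))) := by
      refine (h1.sub ((hL.2.const_smul (ω - ω₀)).sub hT)).congr fun ε => ?_
      abel
    have h3 := h.eq_of_tendsto_truncated hp hp_top hf hfm hA h2
    have h4 : (ω - ω₀) • L = Real.pi • ((ℜ (f ω) : E) - (ℜ A : E)) := by
      rw [smul_sub, ← h3]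
      abel
    rw [div_eq_inv_mul, mul_smul, h4, smul_smul, inv_mul_cancel₀ Real.pi_pos.ne', one_smul]
  · rintro ⟨M, hM⟩
    have h3 := h.eq_of_tendsto_truncated hp hp_top hf hfm hA hM.2
    filter_upwards [hne, h.ae_tendsto_truncated hp hp_top hf hfm] with ω hω hT
    have hω' : ω - ω₀ ≠ 0 := sub_ne_zero.2 hω
    have h1 := tendsto_smul_excised_pair_sub hp hp_top hg hω
    refine ⟨(ω - ω₀)⁻¹ • Real.pi • ((ℜ (f ω) : E) - (ℜ A : E)), ⟨fun ε hε =>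
      (integrableOn_excised_pair hp hp_top hg hω hε).1, ?_⟩, ?_⟩
    · have h2 := (h1.add (hT.sub hM.2)).const_smul (ω - ω₀)⁻¹
      rw [zero_add, h3, ← smul_sub] at h2
      refine h2.congr fun ε => ?_
      rw [sub_add_cancel, smul_smul, inv_mul_cancel₀ hω', one_smul]
    · rw [smul_smul, smul_smul]
      have h2 : (ω - ω₀) / Real.pi * (ω - ω₀)⁻¹ * Real.pi = 1 := by
        have := Real.pi_pos.ne'
        field_simp
      rw [h2, one_smul]

end Subtracted

theorem MemHardy.exists_kramersKronig {E : Type*} [NormedAddCommGroup E] [NormedSpace ℂ E]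
    [StarAddMonoid E] [StarModule ℂ E] [NormedStarGroup E] [FiniteDimensional ℂ E] {p : ℝ≥0∞}
    (hp : 1 < p) (hp_top : p ≠ ∞) {F : ℂ → E} (hF : MemHardy p F) :
    ∃ k : ℝ → E, IsBoundaryValue p F k ∧ PVKramersKronig p k ∧ SubtractedKramersKronig F k := by
  have : CompleteSpace E := FiniteDimensional.complete ℂ E
  obtain ⟨f, hfm, hf, h⟩ := hF.exists_isCauchyRepr hp hp_top
  exact ⟨f, h.isBoundaryValue hp hp_top hf hfm, h.pvKramersKronig hp hp_top hf hfm,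
    h.subtractedKramersKronig hp hp_top hf hfm⟩

/-- `𝓛` is the Liouville space of the system and `K` the frequency-domain memory kernel, with values
in the bounded operators on `𝓛`. The relations hold in operator norm when `𝓛` is
finite-dimensional, and for all matrix elements in general. -/
theorem corollary1 {𝓛 : Type*} [NormedAddCommGroup 𝓛] [InnerProductSpace ℂ 𝓛] [CompleteSpace 𝓛]
    (p : ℝ≥0∞) (hp : 1 < p) (hp_top : p ≠ ∞)
    (K : ℂ → 𝓛 →L[ℂ] 𝓛) (hK : MemHardy p K) :
    (FiniteDimensional ℂ 𝓛 →
      ∃ k : ℝ → 𝓛 →L[ℂ] 𝓛,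
        IsBoundaryValue p K k ∧ PVKramersKronig p k ∧ SubtractedKramersKronig K k) ∧
    (∀ ξ η : 𝓛, ∃ k : ℝ → ℂ,
      IsBoundaryValue p (fun z => ⟪ξ, K z η⟫_ℂ) k ∧ PVKramersKronig p k ∧
        SubtractedKramersKronig (fun z => ⟪ξ, K z η⟫_ℂ) k) := by
  refine ⟨fun hfin => ?_, fun ξ η => ?_⟩
  · exact hK.exists_kramersKronig hp hp_top
  · exact (hK.clm_comp ((innerSL ℂ ξ).comp
      (ContinuousLinearMap.apply ℂ 𝓛 η))).exists_kramersKronig hp hp_top
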